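/- **Setting.** Let $\Omega\subset\mathbb R^{d}$ be open and bounded, let $E(\mu)=\sum_i f_i(\mu)E_i$, $A(\mu)=\sum_i g_i(\mu)A_i$ (real $n\times n$), $B(\mu)=\sum_i h_i(\mu)B_i$ (real $n\times m$), $C(\mu)=\sum_i k_i(\mu)C_i$ (real $p\times n$) with finitely many fixed real matrices and real-analytic functions $f_i,g_i,h_i,k_i$ on $\Omega$. Put $D(\mu,s)=sE(\mu)-A(\mu)$, $H[\mu](s)=C(\mu)D(\mu,s)^{-1}B(\mu)$, and let $\sigma(\mu,\omega)\ge\sigma_2(\mu,\omega)$ be the two largest singular values of $H[\mu](\mathrm i\omega)$ (singular values beyond the last one are $0$). Write $\|H[\mu]\|_{\mathcal H_\infty}=\sup_{\operatorname{Re}s>0}\|H[\mu](s)\|_2$; $H[\mu]\in\mathcal H_\infty$ means that the pencil $D(\mu,\cdot)$ is regular and this supremum is finite. For $V,W\in\mathbb C^{n\times r}$ with orthonormal columns let $D^{V,W}=W^*DV$, $H^{V,W}[\mu](s)=C(\mu)V\,D^{V,W}(\mu,s)^{-1}\,W^*B(\mu)$, and let $\sigma^{V,W},\sigma_2^{V,W}$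 be the two largest singular values of $H^{V,W}[\mu](\mathrm i\omega)$. Subscripts denote partial derivatives; $\sigma_{\min}$ is the smallest singular value; $\overline{\mathcal B}(x,\eta)$ is the closed Euclidean ball. Let $\underline\Omega\subset\Omega$ be compact, $H[\mu]\in\mathcal H_\infty$ for all $\mu\in\underline\Omega$, and let $\mu_*\in\underline\Omega$ be a local (or global) minimizer of $\|H[\cdot]\|_{\mathcal H_\infty}$ on $\underline\Omega$. Assume that $H[\mu]\in\mathcal H_\infty$ for all $\mu$ in a neighbourhood of $\mu_*$ and that $\sigma$, extended to frequencies in $\mathbb R\cup\{\infty\}$ by taking limits in $\omega$ at $\infty$ and at removable singularities of $H[\mu](\mathrm i\,\cdot)$, is continuous at every point of $\{\mu_*\}\times(\mathbb R\cup\{\infty\})$. Assume that the maximum of $\sigma(\mu_*,\cdot)$ over $\mathbb R\cup\{\infty\}$ is attained at some $\omega_*\in\mathbb R$, uniquely up to the sign of $\omega_*$ (the data are real, so $\sigma(\mu,\cdot)$ is even), and that $\sigma(\mu_*,\omega_*)>0$ is a simple singular value, i.e. $\sigma_2(\mu_*,\omega_*)<\sigma(\mu_*,\omega_*)$. **Algorithms.**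 A run of the *basic* algorithm starts from matrices $V_0,W_0$ with orthonormal columns, equally many in both. Step $j\ge1$: choose a minimizer $\mu^{(j)}$ over $\mu\in\underline\Omega$ of $\sup_{\omega\in\mathbb R}\sigma^{V_{j-1},W_{j-1}}(\mu,\omega)$ (taken to be $+\infty$ if the reduced pencil is not regular) and a finite maximizer $\omega^{(j)}$ of $\sigma(\mu^{(j)},\cdot)$ with $D(\mu^{(j)},\mathrm i\omega^{(j)})$ invertible; let $V_j,W_j$ (orthonormal columns, equally many) be such that $\operatorname{Col}V_j=\operatorname{Col}V_{j-1}+\operatorname{Col}\widetilde V$ and $\operatorname{Col}W_j=\operatorname{Col}W_{j-1}+\operatorname{Col}\widetilde W$, where, with everything evaluated at $(\mu^{(j)},\mathrm i\omega^{(j)})$, $\widetilde V=D^{-1}B$ if $m\le p$ and $\widetilde V=D^{-1}BH^*$ if $m>p$, while $\widetilde W=D^{-*}C^*$ if $m\ge p$ and $\widetilde W=D^{-*}C^*H$ if $m<p$. In the *extended* algorithm, for $j\ge2$, the subspaces are moreover enlarged in the same way by the matrices $\widetilde V,\widetilde W$ evaluated at $(\mu^{(j,rq)},\mathrm i\omega^{(j,rq)})$,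 $1\le r\le q\le d$, where $\mu^{(j,rq)}=\mu^{(j)}+\|\mu^{(j)}-\mu^{(j-1)}\|_2\,e_{rq}\in\Omega$, $e_{rr}=e_r$, $e_{rq}=(e_r+e_q)/\sqrt2$ for $r\ne q$, and $\omega^{(j,rq)}$ is a finite maximizer of $\sigma(\mu^{(j,rq)},\cdot)$ with $D(\mu^{(j,rq)},\mathrm i\omega^{(j,rq)})$ invertible. Fix $k\ge1$ and a family of ($k$-step) runs of one of the two algorithms such that $\mu^{(k)}\to\mu_*$ as $\mu^{(1)}\to\mu_*$ and in which the sign of $\omega^{(k)}$ is chosen so that $\omega_*\omega^{(k)}\ge0$. Let $\delta<0$, $\beta>0$ satisfy $\sigma_{\omega\omega}(\mu_*,\omega_*)\le\delta$ and $\sigma_{\min}(D(\mu_*,\mathrm i\omega_*))\ge\beta$. For $\rho>0$ call a run of the family *$\rho$-admissible* if $$\|\mu^{(1)}-\mu_*\|_2<\rho,\qquad \sigma^{V_k,W_k}_{\omega\omega}(\mu_*,\omega_*)\le\delta,\qquad \sigma_{\min}\big(D^{V_k,W_k}(\mu_*,\mathrm i\omega_*)\big)\ge\beta .$$ **Lemma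 (uniform boundedness of higher-order derivatives).** There are $\rho,\eta_{\mu,0},\eta_{\omega,0},\varepsilon>0$, common to all runs of the family, such that, with $\overline{\mathcal B}_\mu=\overline{\mathcal B}(\mu_*,\eta_{\mu,0})$ and $\overline{\mathcal B}_\omega=\overline{\mathcal B}(\omega_*,\eta_{\omega,0})$, the following holds. (a) There is a unique continuous $\boldsymbol\omega:\overline{\mathcal B}_\mu\to\overline{\mathcal B}_\omega$ with $\boldsymbol\omega(\mu_*)=\omega_*$ and $\sigma_\omega(\mu,\boldsymbol\omega(\mu))=0$ for all $\mu\in\overline{\mathcal B}_\mu$. It is $C^3$ in the interior, and on $\overline{\mathcal B}_\mu$ we have $\sigma_{\omega\omega}(\mu,\boldsymbol\omega(\mu))\le\delta/2$, $(\sigma-\sigma_2)(\mu,\boldsymbol\omega(\mu))\ge\varepsilon$, $\boldsymbol\omega(\mu)$ is, uniquely up to sign, the global maximizer of $\sigma(\mu,\cdot)$ on $\mathbb R$, and $\|H[\mu]\|_{\mathcal H_\infty}=\sigma(\mu,\boldsymbol\omega(\mu))$. The function $\|H[\cdot]\|_{\mathcal H_\infty}$ is $C^3$ in the interior of $\overline{\mathcal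 B}_\mu$. (b) For every $\rho$-admissible run, $\mu^{(k)}\in\overline{\mathcal B}_\mu$ and there is a unique continuous $\boldsymbol\omega^{V_k,W_k}:\overline{\mathcal B}_\mu\to\overline{\mathcal B}_\omega$ with $\boldsymbol\omega^{V_k,W_k}(\mu^{(k)})=\omega^{(k)}$ and $\sigma^{V_k,W_k}_\omega(\mu,\boldsymbol\omega^{V_k,W_k}(\mu))=0$ for all $\mu\in\overline{\mathcal B}_\mu$. It is $C^3$ in the interior, and on $\overline{\mathcal B}_\mu$ we have $\sigma^{V_k,W_k}_{\omega\omega}(\mu,\boldsymbol\omega^{V_k,W_k}(\mu))\le\delta/2$, $(\sigma^{V_k,W_k}-\sigma^{V_k,W_k}_2)(\mu,\boldsymbol\omega^{V_k,W_k}(\mu))\ge\varepsilon$, and $\boldsymbol\omega^{V_k,W_k}(\mu)$ is the unique maximizer and the unique stationary point of $\sigma^{V_k,W_k}(\mu,\cdot)$ in $\overline{\mathcal B}_\omega$. The function $\widetilde\sigma^{V_k,W_k}(\mu)=\sigma^{V_k,W_k}(\mu,\boldsymbol\omega^{V_k,W_k}(\mu))$ is $C^3$ in the interior of $\overline{\mathcal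 B}_\mu$. (c) For every $\widehat\eta\in(0,\eta_{\mu,0})$ there is $\gamma>0$, independent of the run (in particular of $\mu^{(1)}$), such that for all $\mu\in\overline{\mathcal B}(\mu_*,\widehat\eta)$, all $\rho$-admissible runs and all $q,r,\ell\in\{1,\dots,d\}$ $$\Big|\frac{\partial^2\|H[\mu]\|_{\mathcal H_\infty}}{\partial\mu_q\partial\mu_r}\Big|\le\gamma,\quad \big|\widetilde\sigma^{V_k,W_k}_{\mu_q\mu_r}(\mu)\big|\le\gamma,\quad \Big|\frac{\partial^3\|H[\mu]\|_{\mathcal H_\infty}}{\partial\mu_q\partial\mu_r\partial\mu_\ell}\Big|\le\gamma,\quad \big|\widetilde\sigma^{V_k,W_k}_{\mu_q\mu_r\mu_\ell}(\mu)\big|\le\gamma .$$ -/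

import Mathlib

open Set Filter Topology Metric
open scoped Matrix ENNReal

noncomputable section

/-- The parameter space `ℝ^d` with the Euclidean norm. -/
abbrev Par (d : ℕ) : Type := EuclideanSpace ℝ (Fin d)

/-- The `i`-th largest singular value of a complex matrix, counted from `i = 0`
(and `0` for an index beyond the number of singular values). -/
def singVal {a b : ℕ} (M : Matrix (Fin a) (Fin b) ℂ) (i : ℕ) : ℝ :=
  (Matrix.toEuclideanLin M).singularValues i

/-- The largest singular value, i.e. the spectral norm. -/
def sigMax {a b : ℕ} (M : Matrix (Fin a) (Fin b) ℂ) : ℝ := singVal M 0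

/-- The second largest singular value. -/
def sigSnd {a b : ℕ} (M : Matrix (Fin a) (Fin b) ℂ) : ℝ := singVal M 1

/-- The smallest singular value of a square matrix (`0` for the empty matrix). -/
def sigMin {a : ℕ} (M : Matrix (Fin a) (Fin a) ℂ) : ℝ := singVal M (a - 1)

/-- The column space of a matrix. -/
def colSpace {a b : ℕ} (M : Matrix (Fin a) (Fin b) ℂ) : Submodule ℂ (Fin a → ℂ) :=
  LinearMap.range M.mulVecLin

/-- The partial derivative of `f : ℝ^d → ℝ` in the `q`-th coordinate. -/
def partialD {d : ℕ} (q : Fin d) (f : Par d → ℝ) : Par d → ℝ :=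
  fun μ => lineDeriv ℝ f μ (EuclideanSpace.single q 1)

/-- The data of a parameter-dependent descriptor system with `d` parameters, order `n`, `m` inputs
and `p` outputs, whose coefficients are combinations of fixed real matrices with real-analytic
coefficient functions on an open bounded set `Ω`. -/
structure ParamSystem (d n m p : ℕ) where
  Ω : Set (Par d)
  isOpen : IsOpen Ω
  isBounded : Bornology.IsBounded Ω
  κE : ℕ
  κA : ℕ
  κB : ℕ
  κC : ℕ
  f : Fin κE → Par d → ℝ
  g : Fin κA → Par d → ℝ
  h : Fin κB → Par d → ℝ
  l : Fin κC → Par d → ℝ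
  f_analytic : ∀ i, AnalyticOnNhd ℝ (f i) Ω
  g_analytic : ∀ i, AnalyticOnNhd ℝ (g i) Ω
  h_analytic : ∀ i, AnalyticOnNhd ℝ (h i) Ω
  l_analytic : ∀ i, AnalyticOnNhd ℝ (l i) Ω
  Emat : Fin κE → Matrix (Fin n) (Fin n) ℝ
  Amat : Fin κA → Matrix (Fin n) (Fin n) ℝ
  Bmat : Fin κB → Matrix (Fin n) (Fin m) ℝ
  Cmat : Fin κC → Matrix (Fin p) (Fin n) ℝ

namespace ParamSystem

variable {d n m p : ℕ} (S : ParamSystem d n m p)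

/-- `E(μ)`, as a complex matrix. -/
def E (μ : Par d) : Matrix (Fin n) (Fin n) ℂ := (∑ i, S.f i μ • S.Emat i).map Complex.ofReal

/-- `A(μ)`, as a complex matrix. -/
def A (μ : Par d) : Matrix (Fin n) (Fin n) ℂ := (∑ i, S.g i μ • S.Amat i).map Complex.ofReal

/-- `B(μ)`, as a complex matrix. -/
def B (μ : Par d) : Matrix (Fin n) (Fin m) ℂ := (∑ i, S.h i μ • S.Bmat i).map Complex.ofReal

/-- `C(μ)`, as a complex matrix. -/
def C (μ : Par d) : Matrix (Fin p) (Fin n) ℂ := (∑ i, S.l i μ • S.Cmat i).map Complex.ofReal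

/-- `D(μ, s) = s E(μ) - A(μ)`. -/
def D (μ : Par d) (s : ℂ) : Matrix (Fin n) (Fin n) ℂ := s • S.E μ - S.A μ

/-- The transfer function `H[μ](s) = C(μ) D(μ, s)⁻¹ B(μ)`. -/
def H (μ : Par d) (s : ℂ) : Matrix (Fin p) (Fin m) ℂ := S.C μ * (S.D μ s)⁻¹ * S.B μ

/-- `σ(μ, ω)`, the largest singular value of `H[μ](iω)`. -/
def sigma (μ : Par d) (ω : ℝ) : ℝ := sigMax (S.H μ (Complex.I * ω))

/-- `σ₂(μ, ω)`, the second largest singular value of `H[μ](iω)`. -/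
def sigma2 (μ : Par d) (ω : ℝ) : ℝ := sigSnd (S.H μ (Complex.I * ω))

/-- `σ(μ, ·)` on `ℝ ∪ {∞}`: the limit of `σ(μ, ω)` as `ω → x`, `ω ≠ x`. If `H[μ]` is bounded on the
imaginary axis, this is the largest singular value of the rational function `H[μ]` at `ix`, also for
`x = ∞` and at removable singularities; where `D(μ, ix)` is invertible it equals `σ(μ, x)`. -/
def sigmaExt (μ : Par d) (x : OnePoint ℝ) : ℝ :=
  limUnder (comap ((↑) : ℝ → OnePoint ℝ) (𝓝[≠] x)) (S.sigma μ)

/-- The pencil `s E(μ) - A(μ)` is regular. -/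
def Regular (μ : Par d) : Prop := ∃ s : ℂ, (S.D μ s).det ≠ 0

/-- The supremum of `‖H[μ](s)‖₂` over the open right half-plane, as an extended number. (For a
regular pencil `D(μ, s)` is singular for finitely many `s` only. These do not change the supremum:
`H[μ]` is unbounded near its poles, and is continuous near a removable singularity.) -/
def hinfENorm (μ : Par d) : ℝ≥0∞ :=
  ⨆ s : {s : ℂ // 0 < s.re}, ENNReal.ofReal (sigMax (S.H μ s))

/-- The `H∞`-norm of `H[μ]`. -/
def hinfNorm (μ : Par d) : ℝ := (S.hinfENorm μ).toReal

/-- `H[μ]` is well defined and belongs to `H∞`. -/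
def InHinf (μ : Par d) : Prop := S.Regular μ ∧ S.hinfENorm μ < ⊤

/-! ### Reduced systems

`V` and `W` hold orthonormal bases of the two subspaces in their columns. By linearity, the reduced
coefficients are the full ones multiplied by `Wᴴ` from the left and by `V` from the right. -/

/-- `D^{V,W}(μ, s)`. -/
def redD {r : ℕ} (V W : Matrix (Fin n) (Fin r) ℂ) (μ : Par d) (s : ℂ) :
    Matrix (Fin r) (Fin r) ℂ :=
  s • (Wᴴ * S.E μ * V) - Wᴴ * S.A μ * V

/-- The reduced transfer function `C^V(μ) D^{V,W}(μ, s)⁻¹ B^W(μ)`. -/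
def redH {r : ℕ} (V W : Matrix (Fin n) (Fin r) ℂ) (μ : Par d) (s : ℂ) :
    Matrix (Fin p) (Fin m) ℂ :=
  (S.C μ * V) * (S.redD V W μ s)⁻¹ * (Wᴴ * S.B μ)

/-- `σ^{V,W}(μ, ω)`. -/
def redSigma {r : ℕ} (V W : Matrix (Fin n) (Fin r) ℂ) (μ : Par d) (ω : ℝ) : ℝ :=
  sigMax (S.redH V W μ (Complex.I * ω))

/-- `σ₂^{V,W}(μ, ω)`. -/
def redSigma2 {r : ℕ} (V W : Matrix (Fin n) (Fin r) ℂ) (μ : Par d) (ω : ℝ) : ℝ :=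
  sigSnd (S.redH V W μ (Complex.I * ω))

open Classical in
/-- The norm of the reduced transfer function that the algorithms minimize: the supremum of
`σ^{V,W}(μ, ·)` on the imaginary axis (reduced systems need not be stable), and `∞` if the reduced
pencil is not regular. -/
def redNorm {r : ℕ} (V W : Matrix (Fin n) (Fin r) ℂ) (μ : Par d) : ℝ≥0∞ :=
  if ∃ s : ℂ, (S.redD V W μ s).det ≠ 0 then ⨆ ω : ℝ, ENNReal.ofReal (S.redSigma V W μ ω) else ⊤

/-! ### The two greedy algorithms -/

/-- `ω` is a (finite) maximizer of `σ(μ, ·)` at which `D(μ, iω)` can be inverted. -/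
def IsMaxFreq (μ : Par d) (ω : ℝ) : Prop :=
  μ ∈ S.Ω ∧ IsUnit (S.D μ (Complex.I * ω)).det ∧ ∀ ω' : ℝ, S.sigma μ ω' ≤ S.sigma μ ω

/-- The space by which the right subspace is expanded for interpolation at `(μ, iω)`. -/
def expandV (μ : Par d) (ω : ℝ) : Submodule ℂ (Fin n → ℂ) :=
  if p < m then
    colSpace ((S.D μ (Complex.I * ω))⁻¹ * S.B μ * (S.H μ (Complex.I * ω))ᴴ)
  else colSpace ((S.D μ (Complex.I * ω))⁻¹ * S.B μ)

/-- The space by which the left subspace is expanded for interpolation at `(μ, iω)`. -/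
def expandW (μ : Par d) (ω : ℝ) : Submodule ℂ (Fin n → ℂ) :=
  if m < p then
    colSpace (((S.D μ (Complex.I * ω))ᴴ)⁻¹ * (S.C μ)ᴴ * S.H μ (Complex.I * ω))
  else colSpace (((S.D μ (Complex.I * ω))ᴴ)⁻¹ * (S.C μ)ᴴ)

end ParamSystem

/-- The direction `e_{rq}`: `e_r` if `r = q`, and `(e_r + e_q)/√2` otherwise. -/
def eDir {d : ℕ} (r q : Fin d) : Par d :=
  if r = q then EuclideanSpace.single r 1
  else (1 / Real.sqrt 2) • (EuclideanSpace.single r 1 + EuclideanSpace.single q 1)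

/-- The two algorithms: the basic one, and the extended one, which interpolates also at points
close to the iterates. -/
inductive Variant
  | basic
  | extended

/-- The quantities that a run of one of the algorithms produces: basis matrices `V j`, `W j` of the
subspaces after step `j` (initial ones for `j = 0`) and their common dimension `r j`, the
iterates `μ j` and `ω j` of step `j ≥ 1`, and the maximizers `ωx j a b` at the neighbouring points of
the extended algorithm. -/
structure GreedyData (d n : ℕ) where
  r : ℕ → ℕ
  V : (j : ℕ) → Matrix (Fin n) (Fin (r j)) ℂ
  W : (j : ℕ) → Matrix (Fin n) (Fin (r j)) ℂ
  μ : ℕ → Par d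
  ω : ℕ → ℝ
  ωx : ℕ → Fin d → Fin d → ℝ

namespace GreedyData

variable {d n m p : ℕ}

/-- The neighbouring point `μ^{(j,ab)} = μ^{(j)} + ‖μ^{(j)} - μ^{(j-1)}‖ e_{ab}`. -/
def μx (R : GreedyData d n) (j : ℕ) (a b : Fin d) : Par d :=
  R.μ j + ‖R.μ j - R.μ (j - 1)‖ • eDir a b

/-- The expansion of the right subspace in step `j`. -/
def stepV (R : GreedyData d n) (S : ParamSystem d n m p) (j : ℕ) :
    Variant → Submodule ℂ (Fin n → ℂ)
  | .basic => S.expandV (R.μ j) (R.ω j)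
  | .extended => S.expandV (R.μ j) (R.ω j) ⊔
      ⨆ (a : Fin d) (b : Fin d) (_ : 2 ≤ j ∧ a ≤ b), S.expandV (R.μx j a b) (R.ωx j a b)

/-- The expansion of the left subspace in step `j`. -/
def stepW (R : GreedyData d n) (S : ParamSystem d n m p) (j : ℕ) :
    Variant → Submodule ℂ (Fin n → ℂ)
  | .basic => S.expandW (R.μ j) (R.ω j)
  | .extended => S.expandW (R.μ j) (R.ω j) ⊔
      ⨆ (a : Fin d) (b : Fin d) (_ : 2 ≤ j ∧ a ≤ b), S.expandW (R.μx j a b) (R.ωx j a b)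

/-- `R` records the first `k` steps of a run of the algorithm `alg` for the minimization of
`‖H[·]‖` over `K`. -/
structure IsRun (R : GreedyData d n) (S : ParamSystem d n m p) (K : Set (Par d)) (alg : Variant)
    (k : ℕ) : Prop where
  orthV : ∀ j ≤ k, (R.V j)ᴴ * R.V j = 1
  orthW : ∀ j ≤ k, (R.W j)ᴴ * R.W j = 1
  mem : ∀ j < k, R.μ (j + 1) ∈ K
  argmin : ∀ j < k, IsMinOn (S.redNorm (R.V j) (R.W j)) K (R.μ (j + 1))
  argmax : ∀ j < k, S.IsMaxFreq (R.μ (j + 1)) (R.ω (j + 1))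
  argmaxx : alg = .extended → ∀ j < k, 2 ≤ j + 1 → ∀ a b : Fin d, a ≤ b →
    S.IsMaxFreq (R.μx (j + 1) a b) (R.ωx (j + 1) a b)
  colV : ∀ j < k, colSpace (R.V (j + 1)) = colSpace (R.V j) ⊔ R.stepV S (j + 1) alg
  colW : ∀ j < k, colSpace (R.W (j + 1)) = colSpace (R.W j) ⊔ R.stepW S (j + 1) alg

end GreedyData

/-- `w` is a continuous function from the closed ball of radius `ημ` around `μs` to the closed
interval of radius `ηω` around `ωs`, with `w μ₀ = ω₀` and `∂g/∂ω (μ, w μ) = 0` on the ball. -/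
structure IsCritBranch {d : ℕ} (g : Par d → ℝ → ℝ) (μs : Par d) (ωs ημ ηω : ℝ)
    (μ₀ : Par d) (ω₀ : ℝ) (w : Par d → ℝ) : Prop where
  cont : ContinuousOn w (closedBall μs ημ)
  maps : MapsTo w (closedBall μs ημ) (closedBall ωs ηω)
  base_mem : μ₀ ∈ closedBall μs ημ
  base : w μ₀ = ω₀
  crit : ∀ μ ∈ closedBall μs ημ, HasDerivAt (g μ) 0 (w μ)

end

/-! ### Singular values of linear maps -/

namespace LinearMap

variable {E F : Type*} [NormedAddCommGroup E] [InnerProductSpace ℂ E] [FiniteDimensional ℂ E]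
  [NormedAddCommGroup F] [InnerProductSpace ℂ F] [FiniteDimensional ℂ F]

/-! The bases `V`, `W` are treated as one more variable θ. Then σ^{V,W}(μ, ω) is a single function
`redFun` of (θ, μ, ω), and the full system is the case V = W = 1. The pairs θ that matter lie in the
sets `gapReducers`: orthonormal columns and, at (μ_*, ω_*), a reduced pencil bounded below by β, a
singular value gap of at least 2ε and curvature at most δ. These sets are compact
(`isCompact_gapReducers`), and only sizes r ≤ n occur. Near such points σ^{V,W} is smooth, because
its square is a simple root of a characteristic polynomial (`contDiffAt_sigMax`). Hence radii and
bounds that exist locally around each θ can be chosen uniformly, independently of the run.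

On a rectangle where `redFun` is strictly concave in ω, a critical frequency near the centre
persists for all μ by the intermediate value theorem (`eventually_exists_crit`), is unique, and
depends smoothly on μ by the implicit function theorem (`exists_branch`). Locally the critical value
is a C³ function of (θ, μ), so its derivatives are bounded around each critical point, and uniformly
on the compact set of critical points (`exists_partialD_bound`).

Admissibility says nothing about the gap or the critical points of the reduced function. Both come
from Hermite interpolation at the last iterate (`redH_hermite`): there the two transfer matrices
coincide, and the squares of their norms agree to first order in ω. So ω^(k), a maximizer for the
full system, is critical for the reduced one, and the gap is that of the full system; uniform
continuity carries it to (μ_*, ω_*) (`eventually_gap_of_gap`).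

For the full system, compactness of ℝ ∪ {∞} confines maximizers to neighbourhoods of ±ω_*
(`eventually_sigma_lt`), which makes the local branch a global maximizer. A Phragmén–Lindelöf
argument identifies its value with the H∞-norm (`hinfNorm_eq`). -/

theorem norm_sq_apply_eq_sum_singularValues (T : E →ₗ[ℂ] F) {n : ℕ}
    (hn : Module.finrank ℂ E = n) (x : E) :
    ‖T x‖ ^ 2 = ∑ i : Fin n, T.singularValues i ^ 2 *
      ‖inner ℂ (T.isSymmetric_adjoint_comp_self.eigenvectorBasis hn i) x‖ ^ 2 := by
  set hT := T.isSymmetric_adjoint_comp_self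
  set b := hT.eigenvectorBasis hn
  have h1 : inner ℂ (T x) (T x) = inner ℂ x ((adjoint T ∘ₗ T) x) := by
    rw [comp_apply, adjoint_inner_right]
  have h2 : ∀ i, inner ℂ (b i) ((adjoint T ∘ₗ T) x)
      = (hT.eigenvalues hn i : ℂ) * inner ℂ (b i) x := by
    intro i
    have := hT.eigenvectorBasis_apply_self_apply hn x i
    rwa [OrthonormalBasis.repr_apply_apply, OrthonormalBasis.repr_apply_apply] at this
  have h3 : inner ℂ (T x) (T x) = ((∑ i : Fin n, T.singularValues i ^ 2 *
      ‖inner ℂ (b i) x‖ ^ 2 : ℝ) : ℂ) := by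
    rw [h1, ← b.sum_inner_mul_inner, Complex.ofReal_sum]
    refine Finset.sum_congr rfl fun i _ => ?_
    rw [h2, T.sq_singularValues_fin hn, Complex.ofReal_mul, Complex.ofReal_pow,
      ← Complex.mul_conj', inner_conj_symm]
    ring
  have h4 := inner_self_eq_norm_sq_to_K (𝕜 := ℂ) (T x)
  rw [h3] at h4
  have h5 : ((∑ i : Fin n, T.singularValues i ^ 2 * ‖inner ℂ (b i) x‖ ^ 2 : ℝ) : ℂ)
      = ((‖T x‖ ^ 2 : ℝ) : ℂ) := by
    rw [h4]; push_cast; rfl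
  exact (Complex.ofReal_injective h5).symm

/-- This and the next lemma are the two halves of the Courant–Fischer principle: in the eigenbasis
of T*T only factors at most σ_j survive here, and only factors at least σ_j there. -/
theorem norm_apply_le_singularValues_mul (T : E →ₗ[ℂ] F) {n : ℕ}
    (hn : Module.finrank ℂ E = n) (j : ℕ) (x : E)
    (hx : ∀ i : Fin n, (i : ℕ) < j →
      inner ℂ (T.isSymmetric_adjoint_comp_self.eigenvectorBasis hn i) x = 0) :
    ‖T x‖ ≤ T.singularValues j * ‖x‖ := by
  refine le_of_sq_le_sq ?_ (mul_nonneg (T.singularValues_nonneg j) (norm_nonneg x))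
  rw [T.norm_sq_apply_eq_sum_singularValues hn, mul_pow,
    ← (T.isSymmetric_adjoint_comp_self.eigenvectorBasis hn).sum_sq_norm_inner_right x,
    Finset.mul_sum]
  refine Finset.sum_le_sum fun i _ => ?_
  rcases lt_or_ge (i : ℕ) j with h | h
  · simp [hx i h]
  · exact mul_le_mul_of_nonneg_right (pow_le_pow_left₀ (T.singularValues_nonneg _)
      (T.singularValues_antitone h) 2) (sq_nonneg _)

theorem singularValues_mul_le_norm_apply (T : E →ₗ[ℂ] F) {n : ℕ}
    (hn : Module.finrank ℂ E = n) (j : ℕ) (x : E)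
    (hx : ∀ i : Fin n, j < (i : ℕ) →
      inner ℂ (T.isSymmetric_adjoint_comp_self.eigenvectorBasis hn i) x = 0) :
    T.singularValues j * ‖x‖ ≤ ‖T x‖ := by
  refine le_of_sq_le_sq ?_ (norm_nonneg _)
  rw [T.norm_sq_apply_eq_sum_singularValues hn, mul_pow,
    ← (T.isSymmetric_adjoint_comp_self.eigenvectorBasis hn).sum_sq_norm_inner_right x,
    Finset.mul_sum]
  refine Finset.sum_le_sum fun i _ => ?_
  rcases lt_or_ge j (i : ℕ) with h | h
  · simp [hx i h]
  · exact mul_le_mul_of_nonneg_right (pow_le_pow_left₀ (T.singularValues_nonneg _)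
      (T.singularValues_antitone h) 2) (sq_nonneg _)

theorem singularValues_zero_eq_norm (T : E →ₗ[ℂ] F) :
    T.singularValues 0 = ‖LinearMap.toContinuousLinearMap T‖ := by
  refine le_antisymm ?_ (ContinuousLinearMap.opNorm_le_bound _ (T.singularValues_nonneg 0)
    fun x => T.norm_apply_le_singularValues_mul rfl 0 x fun i hi => absurd hi (Nat.not_lt_zero _))
  rcases Nat.eq_zero_or_pos (Module.finrank ℂ E) with h | h
  · rw [T.singularValues_of_finrank_le h.le]
    exact norm_nonneg _
  · set b := T.isSymmetric_adjoint_comp_self.eigenvectorBasis (rfl : Module.finrank ℂ E = _)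
    have h1 := T.singularValues_mul_le_norm_apply rfl 0 (b ⟨0, h⟩) fun i hi =>
      b.orthonormal.2 fun e => by simp [e] at hi
    have h2 := (LinearMap.toContinuousLinearMap T).le_opNorm (b ⟨0, h⟩)
    rw [b.norm_eq_one, mul_one] at h1 h2
    exact h1.trans h2

/-- Weyl's inequality for the second singular value. The span of two leading eigenvectors of T*T
contains a nonzero x orthogonal to the leading one of S*S; on it T is at least σ₁(T) and S at most
σ₁(S). -/
theorem singularValues_one_le_add (T S : E →ₗ[ℂ] F) :
    T.singularValues 1 ≤ S.singularValues 1 + ‖LinearMap.toContinuousLinearMap (T - S)‖ := by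
  rcases Nat.lt_or_ge 1 (Module.finrank ℂ E) with h | h
  · set b := T.isSymmetric_adjoint_comp_self.eigenvectorBasis (rfl : Module.finrank ℂ E = _)
    set c := S.isSymmetric_adjoint_comp_self.eigenvectorBasis (rfl : Module.finrank ℂ E = _)
    let i0 : Fin (Module.finrank ℂ E) := ⟨0, by omega⟩
    let i1 : Fin (Module.finrank ℂ E) := ⟨1, h⟩
    have h01 : i0 ≠ i1 := by simp [i0, i1, Fin.ext_iff]
    obtain ⟨x, hx0, hxb, hxc⟩ : ∃ x : E, x ≠ 0 ∧ (∀ i : Fin (Module.finrank ℂ E), 1 < (i : ℕ) → inner ℂ (b i) x = 0) ∧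
        inner ℂ (c i0) x = 0 := by
      have horth : ∀ i : Fin (Module.finrank ℂ E), 1 < (i : ℕ) →
          inner ℂ (b i) (b i0) = 0 ∧ inner ℂ (b i) (b i1) = 0 := fun i hi =>
        ⟨b.orthonormal.2 fun e => by simp [e, i0] at hi,
          b.orthonormal.2 fun e => by simp [e, i1] at hi⟩
      by_cases h0 : inner ℂ (c i0) (b i0) = 0
      · exact ⟨b i0, b.orthonormal.ne_zero i0, fun i hi => (horth i hi).1, h0⟩
      -- The coefficients make the products with `c i0` cancel; the vector is nonzero because its `b
      -- i1`-coefficient is -⟨c i0, b i0⟩.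
      · refine ⟨inner ℂ (c i0) (b i1) • b i0 - inner ℂ (c i0) (b i0) • b i1, fun h => h0 ?_,
          fun i hi => ?_, ?_⟩
        · have := congrArg (inner ℂ (b i1)) h
          simpa [inner_sub_right, inner_smul_right, b.orthonormal.2 h01.symm,
            inner_self_eq_norm_sq_to_K] using this
        · rw [inner_sub_right, inner_smul_right, inner_smul_right, (horth i hi).1, (horth i hi).2]; simp
        · simp only [inner_sub_right, inner_smul_right]; ring
    have h1 := T.singularValues_mul_le_norm_apply rfl 1 x hxb
    have h2 := S.norm_apply_le_singularValues_mul rfl 1 x fun i hi => by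
      have : i = i0 := Fin.ext (by simpa [i0] using hi)
      rw [this]; exact hxc
    have h3 := (LinearMap.toContinuousLinearMap (T - S)).le_opNorm x
    have h4 : ‖T x‖ ≤ ‖S x‖ + ‖(T - S) x‖ := by
      have := norm_add_le (S x) ((T - S) x)
      simpa using this
    have hpos : 0 < ‖x‖ := norm_pos_iff.2 hx0
    refine le_of_mul_le_mul_right ?_ hpos
    simp only [coe_toContinuousLinearMap'] at h3
    linarith
  · rw [T.singularValues_of_finrank_le h, S.singularValues_of_finrank_le h]
    positivity

end LinearMap

/-! ### Singular values of matrices -/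

section MatrixSingularValues

open scoped Matrix.Norms.L2Operator

variable {a b c : ℕ}

theorem sigMax_eq_norm (M : Matrix (Fin a) (Fin b) ℂ) : sigMax M = ‖M‖ := by
  rw [Matrix.l2_opNorm_def]
  exact (Matrix.toEuclideanLin M).singularValues_zero_eq_norm

theorem sigMax_nonneg (M : Matrix (Fin a) (Fin b) ℂ) : 0 ≤ sigMax M :=
  (Matrix.toEuclideanLin M).singularValues_nonneg 0

theorem sigSnd_nonneg (M : Matrix (Fin a) (Fin b) ℂ) : 0 ≤ sigSnd M :=
  (Matrix.toEuclideanLin M).singularValues_nonneg 1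

theorem sigSnd_le_add (M N : Matrix (Fin a) (Fin b) ℂ) : sigSnd M ≤ sigSnd N + ‖M - N‖ := by
  have := (Matrix.toEuclideanLin M).singularValues_one_le_add (Matrix.toEuclideanLin N)
  rw [← map_sub] at this
  rw [Matrix.l2_opNorm_def]
  exact this

theorem continuous_sigSnd : Continuous (sigSnd : Matrix (Fin a) (Fin b) ℂ → ℝ) := by
  refine LipschitzWith.continuous (K := 1) (LipschitzWith.of_dist_le_mul fun M N => ?_)
  rw [Real.dist_eq, abs_sub_le_iff, dist_eq_norm, NNReal.coe_one, one_mul]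
  have h1 := sigSnd_le_add M N
  have h2 := sigSnd_le_add N M
  rw [norm_sub_rev] at h2
  constructor <;> linarith

theorem continuous_sigMax : Continuous (sigMax : Matrix (Fin a) (Fin b) ℂ → ℝ) := by
  rw [show (sigMax : Matrix (Fin a) (Fin b) ℂ → ℝ) = fun M => ‖M‖ from funext sigMax_eq_norm]
  exact continuous_norm

theorem sigMin_mul_norm_le (M : Matrix (Fin a) (Fin a) ℂ) (x : EuclideanSpace ℂ (Fin a)) :
    sigMin M * ‖x‖ ≤ ‖Matrix.toEuclideanLin M x‖ :=
  (Matrix.toEuclideanLin M).singularValues_mul_le_norm_apply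
    (by simp : Module.finrank ℂ (EuclideanSpace ℂ (Fin a)) = a) (a - 1) x
    fun i hi => by have := i.2; omega

theorem det_ne_zero_of_le_norm {β : ℝ} (hβ : 0 < β) (M : Matrix (Fin a) (Fin a) ℂ)
    (h : ∀ x : EuclideanSpace ℂ (Fin a), β * ‖x‖ ≤ ‖Matrix.toEuclideanLin M x‖) :
    M.det ≠ 0 := by
  intro h0
  obtain ⟨v, hv, hv0⟩ := Matrix.exists_mulVec_eq_zero_iff.2 h0
  have := h (WithLp.toLp 2 v)
  rw [Matrix.toLpLin_toLp, Matrix.toLin'_apply, hv0] at this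
  have h1 : 0 < ‖(WithLp.toLp 2 v : EuclideanSpace ℂ (Fin a))‖ := by
    rw [norm_pos_iff]; simpa using hv
  have h2 : ‖(WithLp.toLp 2 (0 : Fin a → ℂ) : EuclideanSpace ℂ (Fin a))‖ = 0 := by simp
  rw [h2] at this
  nlinarith

/-- Conjugating the entries of a vector preserves its norm and turns M into its entrywise conjugate.
This is what will make σ(μ, ·) even. -/
theorem sigMax_map_conj_le (M : Matrix (Fin a) (Fin b) ℂ) : sigMax (M.map star) ≤ sigMax M := by
  rw [sigMax_eq_norm, sigMax_eq_norm, Matrix.l2_opNorm_def (M.map star)]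
  refine ContinuousLinearMap.opNorm_le_bound _ (norm_nonneg _) fun x => ?_
  have key := Matrix.l2_opNorm_mulVec M (WithLp.toLp 2 (star x.ofLp))
  have e1 : ‖(WithLp.toLp 2 (star x.ofLp) : EuclideanSpace ℂ (Fin b))‖ = ‖x‖ := by
    simp [EuclideanSpace.norm_eq]
  have e2 : ‖(EuclideanSpace.equiv (Fin a) ℂ).symm (M *ᵥ star x.ofLp)‖
      = ‖(Matrix.toEuclideanLin (M.map star)) x‖ := by
    have : M *ᵥ star x.ofLp = star ((M.map star) *ᵥ x.ofLp) := by
      ext i; simp [Matrix.mulVec, dotProduct]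
    simp [EuclideanSpace.norm_eq, this]
  rw [e1] at key
  simp only [e2] at key
  exact key

theorem sigMax_map_conj (M : Matrix (Fin a) (Fin b) ℂ) : sigMax (M.map star) = sigMax M := by
  refine le_antisymm (sigMax_map_conj_le M) ?_
  have := sigMax_map_conj_le (M.map star)
  rwa [Matrix.map_map, show (star ∘ star : ℂ → ℂ) = id from funext star_star, Matrix.map_id] at this

/-- Exhibits the squared singular values, with multiplicity, as roots of a polynomial whose
coefficients are smooth in M. -/
theorem charpoly_conjTranspose_mul_self (M : Matrix (Fin a) (Fin b) ℂ) :
    (Mᴴ * M).charpoly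
      = ∏ i : Fin b, (Polynomial.X - Polynomial.C ((singVal M i ^ 2 : ℝ) : ℂ)) := by
  set T := Matrix.toEuclideanLin M
  have hn : Module.finrank ℂ (EuclideanSpace ℂ (Fin b)) = b := by simp
  have h := T.isSymmetric_adjoint_comp_self.charpoly_eq hn
  have h2 : (LinearMap.adjoint T ∘ₗ T) = Matrix.toEuclideanLin (Mᴴ * M) := by
    rw [← Matrix.toEuclideanLin_conjTranspose_eq_adjoint]
    ext x : 1
    simp [T, Matrix.toLpLin_apply]
  have h3 : (LinearMap.adjoint T ∘ₗ T).charpoly = (Mᴴ * M).charpoly := by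
    rw [h2, Matrix.toEuclideanLin, Matrix.toLpLin_eq_toLin, Matrix.charpoly_toLin]
  rw [← h3, h]
  refine Finset.prod_congr rfl fun i _ => ?_
  rw [singVal, T.sq_singularValues_fin hn]
  rfl

end MatrixSingularValues

/-! ### Smooth matrix functions and smoothness of a simple largest singular value -/

theorem ContinuousLinearMap.isInvertible_of_apply_one_ne_zero (L : ℝ →L[ℝ] ℝ) (h : L 1 ≠ 0) :
    L.IsInvertible :=
  ⟨ContinuousLinearEquiv.unitsEquivAut ℝ (Units.mk0 _ h), by ext; simp⟩

section MatrixCalculus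

open scoped Matrix.Norms.L2Operator

variable {a b c : ℕ} {X : Type*} [NormedAddCommGroup X] [NormedSpace ℝ X] {n : WithTop ℕ∞} {x : X}

theorem contDiffAt_matrix {f : X → Matrix (Fin a) (Fin b) ℂ} :
    ContDiffAt ℝ n f x ↔ ∀ i j, ContDiffAt ℝ n (fun y => f y i j) x := by
  let e : Matrix (Fin a) (Fin b) ℂ ≃L[ℝ] (Fin a → Fin b → ℂ) :=
    ((Matrix.ofLinearEquiv ℝ).symm).toContinuousLinearEquiv
  rw [← e.comp_contDiffAt_iff, contDiffAt_pi]
  refine forall_congr' fun i => ?_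
  rw [contDiffAt_pi]
  rfl

theorem ContDiffAt.matrix_mul {f : X → Matrix (Fin a) (Fin b) ℂ} {g : X → Matrix (Fin b) (Fin c) ℂ}
    (hf : ContDiffAt ℝ n f x) (hg : ContDiffAt ℝ n g x) :
    ContDiffAt ℝ n (fun y => f y * g y) x := by
  rw [contDiffAt_matrix] at *
  intro i j
  simp only [Matrix.mul_apply]
  exact ContDiffAt.sum fun k _ => (hf i k).mul (hg k j)

theorem ContDiffAt.matrix_conjTranspose {f : X → Matrix (Fin a) (Fin b) ℂ}
    (hf : ContDiffAt ℝ n f x) : ContDiffAt ℝ n (fun y => (f y)ᴴ) x := by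
  rw [contDiffAt_matrix] at *
  intro i j
  simp only [Matrix.conjTranspose_apply]
  exact Complex.conjCLE.contDiff.contDiffAt.comp x (hf j i)

theorem ContDiffAt.matrix_det {f : X → Matrix (Fin a) (Fin a) ℂ}
    (hf : ContDiffAt ℝ n f x) : ContDiffAt ℝ n (fun y => (f y).det) x := by
  rw [contDiffAt_matrix] at hf
  simp only [Matrix.det_apply']
  exact ContDiffAt.sum fun s _ => contDiffAt_const.mul (contDiffAt_prod fun i _ => hf _ _)

theorem ContDiffAt.matrix_inv {f : X → Matrix (Fin a) (Fin a) ℂ}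
    (hf : ContDiffAt ℝ n f x) (h : (f x).det ≠ 0) : ContDiffAt ℝ n (fun y => (f y)⁻¹) x := by
  obtain ⟨u, hu⟩ := (Matrix.isUnit_iff_isUnit_det (f x)).2 (isUnit_iff_ne_zero.2 h)
  have h1 := contDiffAt_ringInverse (n := n) ℝ u
  rw [hu] at h1
  have h2 := h1.comp x hf
  refine h2.congr_of_eventuallyEq (Eventually.of_forall fun y => ?_)
  exact Matrix.nonsing_inv_eq_ringInverse _

/-- By the gap, σ² is a simple root of det(t - MᴴM), so the implicit function theorem yields a
smooth root near it. Continuity of σ identifies that root with σ², and the square root is smooth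
since σ > 0. -/
theorem contDiffAt_sigMax {M₀ : Matrix (Fin a) (Fin b) ℂ} (h : sigSnd M₀ < sigMax M₀) :
    ContDiffAt ℝ n (sigMax : Matrix (Fin a) (Fin b) ℂ → ℝ) M₀ := by
  have hpos : 0 < sigMax M₀ := (sigSnd_nonneg M₀).trans_lt h
  have hb : 0 < b := by
    by_contra hb
    refine hpos.ne' ((Matrix.toEuclideanLin M₀).singularValues_of_finrank_le ?_)
    simpa using hb
  let f : Matrix (Fin a) (Fin b) ℂ × ℝ → ℝ := fun z =>
    (((z.2 : ℂ) • (1 : Matrix (Fin b) (Fin b) ℂ) - z.1ᴴ * z.1).det).re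
  have hfprod : ∀ M t, f (M, t) = ∏ i : Fin b, (t - singVal M i ^ 2) := by
    intro M t
    have h1 := Matrix.eval_charpoly (Mᴴ * M) (t : ℂ)
    rw [charpoly_conjTranspose_mul_self, Polynomial.eval_prod] at h1
    simp only [f]
    rw [Matrix.smul_one_eq_diagonal, ← Matrix.scalar_apply, ← h1]
    simp only [Polynomial.eval_sub, Polynomial.eval_X, Polynomial.eval_C]
    rw [← Complex.ofReal_re (∏ i : Fin b, (t - singVal M i ^ 2))]
    push_cast
    rfl
  have hfroot : ∀ M, f (M, sigMax M ^ 2) = 0 := fun M => by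
    rw [hfprod]
    exact Finset.prod_eq_zero (Finset.mem_univ (⟨0, hb⟩ : Fin b)) (sub_self _)
  have hfsmooth : ∀ k : WithTop ℕ∞, ∀ z, ContDiffAt ℝ k f z := by
    intro k z
    have h1 : ContDiffAt ℝ k (fun z : Matrix (Fin a) (Fin b) ℂ × ℝ =>
        (z.2 : ℂ) • (1 : Matrix (Fin b) (Fin b) ℂ) - z.1ᴴ * z.1) z :=
      ((Complex.ofRealCLM.contDiff.contDiffAt.comp z contDiffAt_snd).smul contDiffAt_const).sub
        ((contDiffAt_fst.matrix_conjTranspose).matrix_mul contDiffAt_fst)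
    exact Complex.reCLM.contDiff.contDiffAt.comp z h1.matrix_det
  have hderiv : (fderiv ℝ f (M₀, sigMax M₀ ^ 2) ∘L .inr ℝ _ ℝ) 1 ≠ 0 := by
    have h1 : HasDerivAt (fun t => f (M₀, t))
        ((fderiv ℝ f (M₀, sigMax M₀ ^ 2) ∘L .inr ℝ _ ℝ) 1) (sigMax M₀ ^ 2) := by
      have h2 := ((hfsmooth 1 (M₀, sigMax M₀ ^ 2)).differentiableAt one_ne_zero).hasFDerivAt
      have h3 : HasDerivAt (fun t : ℝ => (M₀, t)) ((0 : Matrix (Fin a) (Fin b) ℂ), (1 : ℝ))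
        (sigMax M₀ ^ 2) := (hasDerivAt_const _ _).prodMk (hasDerivAt_id _)
      exact h2.comp_hasDerivAt _ h3
    -- At the root t = σ² the product rule leaves only the product of the other factors, each of
    -- which is positive by the gap.
    have h4 : HasDerivAt (fun t => f (M₀, t))
        (∏ i ∈ (Finset.univ : Finset (Fin b)).erase ⟨0, hb⟩,
          (sigMax M₀ ^ 2 - singVal M₀ i ^ 2)) (sigMax M₀ ^ 2) := by
      have h5 : (fun t => f (M₀, t)) = fun t => (t - sigMax M₀ ^ 2) *
          ∏ i ∈ (Finset.univ : Finset (Fin b)).erase ⟨0, hb⟩, (t - singVal M₀ i ^ 2) := by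
        funext t
        rw [hfprod, ← Finset.mul_prod_erase _ _ (Finset.mem_univ (⟨0, hb⟩ : Fin b))]
        rfl
      rw [h5]
      have h6 : DifferentiableAt ℝ (fun t : ℝ =>
          ∏ i ∈ (Finset.univ : Finset (Fin b)).erase ⟨0, hb⟩, (t - singVal M₀ i ^ 2))
          (sigMax M₀ ^ 2) := by fun_prop
      have h7 := ((hasDerivAt_id (sigMax M₀ ^ 2)).sub_const (sigMax M₀ ^ 2)).mul h6.hasDerivAt
      convert! h7 using 1
      simp
    rw [h1.unique h4, Finset.prod_ne_zero_iff]
    intro i hi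
    have hi0 : 1 ≤ (i : ℕ) := by
      rcases Nat.eq_zero_or_pos (i : ℕ) with h0 | h0
      · exact absurd (Fin.ext h0) (Finset.ne_of_mem_erase hi)
      · exact h0
    have h8 : singVal M₀ i ≤ sigSnd M₀ := (Matrix.toEuclideanLin M₀).singularValues_antitone hi0
    have h9 : 0 ≤ singVal M₀ i := (Matrix.toEuclideanLin M₀).singularValues_nonneg i
    nlinarith
  have hinv := ContinuousLinearMap.isInvertible_of_apply_one_ne_zero _ hderiv
  have key : ∀ k : WithTop ℕ∞, k ≠ 0 →
      ContDiffAt ℝ k (sigMax : Matrix (Fin a) (Fin b) ℂ → ℝ) M₀ := by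
    intro k hk
    have hc := hfsmooth k (M₀, sigMax M₀ ^ 2)
    have h1 := hc.contDiffAt_implicitFunction hk hinv
    have hcont : Tendsto (fun M : Matrix (Fin a) (Fin b) ℂ => (M, sigMax M ^ 2)) (𝓝 M₀)
        (𝓝 (M₀, sigMax M₀ ^ 2)) :=
      (continuous_id.prodMk (continuous_sigMax.pow 2)).tendsto M₀
    have h2 := hcont.eventually (hc.eventually_apply_eq_iff_implicitFunction hk hinv)
    have h3 : sigMax =ᶠ[𝓝 M₀] fun M => √(hc.implicitFunction hk hinv M) := by
      filter_upwards [h2] with M hM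
      rw [hM.1 (by rw [hfroot, hfroot])]
      exact (Real.sqrt_sq ((Matrix.toEuclideanLin M).singularValues_nonneg 0)).symm
    refine (h1.sqrt ?_).congr_of_eventuallyEq h3
    have := hc.implicitFunction_apply_self hk hinv
    simp only at this
    rw [this]
    positivity
  -- The implicit function theorem needs a positive order of smoothness, hence the maximum with 1.
  exact (key (max n 1) (by simp)).of_le (le_max_left _ _)

end MatrixCalculus

/-! ### Concave functions of one variable -/

theorem deriv_sub_le_of_second_deriv_le {g' g'' : ℝ → ℝ} {a b c : ℝ}
    (h : ∀ t ∈ Icc a b, HasDerivAt g' (g'' t) t) (hc : ∀ t ∈ Icc a b, g'' t ≤ c) {s t : ℝ}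
    (hs : s ∈ Icc a b) (ht : t ∈ Icc a b) (hst : s ≤ t) : g' t - g' s ≤ c * (t - s) := by
  refine (convex_Icc a b).image_sub_le_mul_sub_of_deriv_le
    (fun x hx => (h x hx).continuousAt.continuousWithinAt)
    (fun x hx => (h x (interior_subset hx)).differentiableAt.differentiableWithinAt)
    (fun x hx => ?_) s hs t ht hst
  rw [(h x (interior_subset hx)).deriv]
  exact hc x (interior_subset hx)

/-- The derivative decreases strictly through its zero w, so it is positive to the left and negative
to the right; the mean value theorem then compares the values. -/
theorem lt_and_deriv_ne_zero_of_second_deriv_neg {g g' g'' : ℝ → ℝ} {a b c w t : ℝ}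
    (h : ∀ t ∈ Icc a b, HasDerivAt g (g' t) t)
    (h' : ∀ t ∈ Icc a b, HasDerivAt g' (g'' t) t) (hc : ∀ t ∈ Icc a b, g'' t ≤ c) (hc0 : c < 0)
    (hw : w ∈ Icc a b) (hw0 : g' w = 0) (ht : t ∈ Icc a b) (htw : t ≠ w) :
    g t < g w ∧ g' t ≠ 0 := by
  rcases lt_or_gt_of_ne htw with hlt | hlt
  · have hpos : ∀ s ∈ Icc a b, s < w → 0 < g' s := fun s hs hsw => by
      have := deriv_sub_le_of_second_deriv_le h' hc hs hw hsw.le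
      nlinarith
    refine ⟨?_, (hpos t ht hlt).ne'⟩
    have hsub : Icc t w ⊆ Icc a b := Icc_subset_Icc ht.1 hw.2
    obtain ⟨s, hs, hs'⟩ := exists_hasDerivAt_eq_slope g g' hlt
      (fun x hx => (h x (hsub hx)).continuousAt.continuousWithinAt)
      (fun x hx => h x (hsub (Ioo_subset_Icc_self hx)))
    have := hpos s (hsub (Ioo_subset_Icc_self hs)) hs.2
    rw [hs', div_pos_iff_of_pos_right (sub_pos.2 hlt)] at this
    linarith
  · have hneg : ∀ s ∈ Icc a b, w < s → g' s < 0 := fun s hs hsw => by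
      have := deriv_sub_le_of_second_deriv_le h' hc hw hs hsw.le
      nlinarith
    refine ⟨?_, (hneg t ht hlt).ne⟩
    have hsub : Icc w t ⊆ Icc a b := Icc_subset_Icc hw.1 ht.2
    obtain ⟨s, hs, hs'⟩ := exists_hasDerivAt_eq_slope g g' hlt
      (fun x hx => (h x (hsub hx)).continuousAt.continuousWithinAt)
      (fun x hx => h x (hsub (Ioo_subset_Icc_self hx)))
    have := hneg s (hsub (Ioo_subset_Icc_self hs)) hs.1
    rw [hs', div_lt_iff₀ (sub_pos.2 hlt)] at this
    linarith

/-! ### Partial derivatives -/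

/-- The partial derivative with respect to a real last variable. -/
noncomputable def derivSnd {X : Type*} (F : X × ℝ → ℝ) (z : X × ℝ) : ℝ :=
  deriv (fun t => F (z.1, t)) z.2

section Partial

variable {X : Type*} [NormedAddCommGroup X] [NormedSpace ℝ X] {F : X × ℝ → ℝ} {z : X × ℝ}

theorem hasDerivAt_slice (h : DifferentiableAt ℝ F z) :
    HasDerivAt (fun t => F (z.1, t)) (fderiv ℝ F z (0, 1)) z.2 := by
  have h3 : HasDerivAt (fun t : ℝ => (z.1, t)) ((0 : X), (1 : ℝ)) z.2 :=
    (hasDerivAt_const _ _).prodMk (hasDerivAt_id _)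
  exact (h.hasFDerivAt (x := z)).comp_hasDerivAt z.2 h3

theorem hasDerivAt_derivSnd (h : DifferentiableAt ℝ F z) :
    HasDerivAt (fun t => F (z.1, t)) (derivSnd F z) z.2 :=
  (hasDerivAt_slice h).differentiableAt.hasDerivAt

theorem ContDiffAt.derivSnd {k : ℕ} (h : ContDiffAt ℝ (k + 1 : ℕ) F z) :
    ContDiffAt ℝ k (derivSnd F) z := by
  have h1 : ContDiffAt ℝ k (fun z => fderiv ℝ F z (0, 1)) z :=
    (h.fderiv_right (m := k) (by simp)).clm_apply contDiffAt_const
  refine h1.congr_of_eventuallyEq ?_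
  filter_upwards [h.eventually (by simp)] with y hy
  exact (hasDerivAt_slice (hy.differentiableAt (by simp))).deriv

theorem ContDiffAt.lineDeriv {k : ℕ} {G : X → ℝ} {x : X} (v : X)
    (h : ContDiffAt ℝ (k + 1 : ℕ) G x) : ContDiffAt ℝ k (fun y => lineDeriv ℝ G y v) x := by
  have h1 : ContDiffAt ℝ k (fun y => fderiv ℝ G y v) x :=
    (h.fderiv_right (m := k) (by simp)).clm_apply contDiffAt_const
  refine h1.congr_of_eventuallyEq ?_
  filter_upwards [h.eventually (by simp)] with y hy
  exact (hy.differentiableAt (by simp)).lineDeriv_eq_fderiv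

variable {d : ℕ}

theorem partialD_congr {f g : Par d → ℝ} {μ : Par d} (h : f =ᶠ[𝓝 μ] g) (q : Fin d) :
    partialD q f =ᶠ[𝓝 μ] partialD q g := by
  filter_upwards [h.eventuallyEq_nhds] with ν hν
  exact hν.lineDeriv_eq

/-- Turns derivatives at fixed θ into directional derivatives of the joint function, whose
continuity in (θ, μ) gives bounds uniform in θ. -/
theorem partialD_slice (G : X × Par d → ℝ) (θ : X) (q : Fin d) :
    partialD q (fun ν => G (θ, ν)) =
      fun ν => lineDeriv ℝ G (θ, ν) (0, EuclideanSpace.single q 1) := by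
  funext ν
  simp [partialD, lineDeriv]

end Partial

/-! ### Uniform neighbourhoods -/

theorem eventually_closedBall_of_eventually_nhds {P : Type*} [PseudoMetricSpace P] {x : P}
    {p : P → Prop} (h : ∀ᶠ y in 𝓝 x, p y) :
    ∀ᶠ η in 𝓝[>] (0 : ℝ), ∀ y ∈ closedBall x η, p y := by
  obtain ⟨ε, hε, h⟩ := Metric.eventually_nhds_iff.1 h
  filter_upwards [Ioo_mem_nhdsGT hε] with η hη y hy
  exact h ((mem_closedBall.1 hy).trans_lt hη.2)

/-- The tube lemma. The nested quantifiers let ηω be fixed first and ημ be shrunk afterwards,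
depending on ηω. -/
theorem eventually_rect {Θ P : Type*} [TopologicalSpace Θ] [PseudoMetricSpace P] {K : Set Θ}
    (hK : IsCompact K) {x : P} {t : ℝ} {p : (Θ × P) × ℝ → Prop}
    (h : ∀ θ ∈ K, ∀ᶠ z in 𝓝 ((θ, x), t), p z) :
    ∀ᶠ ηω in 𝓝[>] (0 : ℝ), ∀ᶠ ημ in 𝓝[>] (0 : ℝ),
      ∀ θ ∈ K, ∀ y ∈ closedBall x ημ, ∀ s ∈ closedBall t ηω, p ((θ, y), s) := by
  have h1 : ∀ᶠ v : P × ℝ in 𝓝 (x, t), ∀ θ ∈ K, p ((θ, v.1), v.2) := by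
    refine hK.eventually_forall_of_forall_eventually fun θ hθ => ?_
    have hc : Tendsto (fun u : (P × ℝ) × Θ => ((u.2, u.1.1), u.1.2)) (𝓝 ((x, t), θ))
        (𝓝 ((θ, x), t)) :=
      Continuous.tendsto (by fun_prop) ((x, t), θ)
    exact hc.eventually (h θ hθ)
  obtain ⟨ε, hε, h2⟩ := Metric.eventually_nhds_iff.1 h1
  filter_upwards [Ioo_mem_nhdsGT hε] with ηω hω
  filter_upwards [Ioo_mem_nhdsGT hε] with ημ hμ θ hθ y hy s hs
  exact h2 (y := (y, s)) (by
    rw [Prod.dist_eq, max_lt_iff]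
    exact ⟨(mem_closedBall.1 hy).trans_lt hμ.2, (mem_closedBall.1 hs).trans_lt hω.2⟩) θ hθ

/-! ### Branches of critical points -/

/-- `F` is smooth, and uniformly concave in its last variable, on a rectangle. -/
def ConcaveRect {Θ : Type*} [NormedAddCommGroup Θ] [NormedSpace ℝ Θ] {d : ℕ}
    (F : (Θ × Par d) × ℝ → ℝ) (c : ℝ) (μs : Par d) (ωs ημ ηω : ℝ) (θ : Θ) : Prop :=
  ∀ μ ∈ closedBall μs ημ, ∀ ω ∈ closedBall ωs ηω,
    ContDiffAt ℝ (5 : ℕ) F ((θ, μ), ω) ∧ derivSnd (derivSnd F) ((θ, μ), ω) ≤ c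

section Branch

variable {Θ : Type*} [NormedAddCommGroup Θ] [NormedSpace ℝ Θ] {d : ℕ}
  {F : (Θ × Par d) × ℝ → ℝ} {μs : Par d} {ωs ημ ηω c : ℝ} {θ : Θ} {w : Par d → ℝ}

namespace ConcaveRect

theorem hasDerivAt (h : ConcaveRect F c μs ωs ημ ηω θ) {μ : Par d} (hμ : μ ∈ closedBall μs ημ)
    {ω : ℝ} (hω : ω ∈ closedBall ωs ηω) :
    HasDerivAt (fun t => F ((θ, μ), t)) (derivSnd F ((θ, μ), ω)) ω :=
  hasDerivAt_derivSnd (z := ((θ, μ), ω)) ((h μ hμ ω hω).1.differentiableAt (by simp))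

theorem hasDerivAt_two (h : ConcaveRect F c μs ωs ημ ηω θ) {μ : Par d}
    (hμ : μ ∈ closedBall μs ημ) {ω : ℝ} (hω : ω ∈ closedBall ωs ηω) :
    HasDerivAt (fun t => derivSnd F ((θ, μ), t)) (derivSnd (derivSnd F) ((θ, μ), ω)) ω :=
  hasDerivAt_derivSnd (z := ((θ, μ), ω))
    ((h μ hμ ω hω).1.derivSnd (k := 4).differentiableAt (by simp))

theorem deriv_sub_le (h : ConcaveRect F c μs ωs ημ ηω θ) {μ : Par d}
    (hμ : μ ∈ closedBall μs ημ) {s t : ℝ} (hs : s ∈ closedBall ωs ηω) (ht : t ∈ closedBall ωs ηω)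
    (hst : s ≤ t) : derivSnd F ((θ, μ), t) - derivSnd F ((θ, μ), s) ≤ c * (t - s) := by
  rw [Real.closedBall_eq_Icc] at hs ht
  exact deriv_sub_le_of_second_deriv_le (g' := fun t => derivSnd F ((θ, μ), t))
    (fun x hx => h.hasDerivAt_two hμ (by rwa [Real.closedBall_eq_Icc]))
    (fun x hx => (h μ hμ x (by rwa [Real.closedBall_eq_Icc])).2) hs ht hst

theorem lt_and_ne (h : ConcaveRect F c μs ωs ημ ηω θ) (hc : c < 0) {μ : Par d}
    (hμ : μ ∈ closedBall μs ημ) {s t : ℝ} (hs : s ∈ closedBall ωs ηω) (ht : t ∈ closedBall ωs ηω)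
    (hs0 : derivSnd F ((θ, μ), s) = 0) (hst : t ≠ s) :
    F ((θ, μ), t) < F ((θ, μ), s) ∧ derivSnd F ((θ, μ), t) ≠ 0 := by
  rw [Real.closedBall_eq_Icc] at hs ht
  exact lt_and_deriv_ne_zero_of_second_deriv_neg (g := fun t => F ((θ, μ), t))
    (g' := fun t => derivSnd F ((θ, μ), t))
    (fun x hx => h.hasDerivAt hμ (by rwa [Real.closedBall_eq_Icc]))
    (fun x hx => h.hasDerivAt_two hμ (by rwa [Real.closedBall_eq_Icc]))
    (fun x hx => (h μ hμ x (by rwa [Real.closedBall_eq_Icc])).2) hc hs hs0 ht hst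

end ConcaveRect

/-- Relaxing δ to δ/2 leaves room for continuity of the second derivative to spread the bound from
the centre to a rectangle. -/
theorem eventually_concaveRect {K : Set Θ} (hK : IsCompact K) {δ : ℝ} (hδ : δ < 0)
    (hF : ∀ θ ∈ K, ContDiffAt ℝ (5 : ℕ) F ((θ, μs), ωs))
    (hcurv : ∀ θ ∈ K, derivSnd (derivSnd F) ((θ, μs), ωs) ≤ δ) :
    ∀ᶠ ηω in 𝓝[>] (0 : ℝ), ∀ᶠ ημ in 𝓝[>] (0 : ℝ),
      ∀ θ ∈ K, ConcaveRect F (δ / 2) μs ωs ημ ηω θ := by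
  refine eventually_rect (p := fun z => ContDiffAt ℝ (5 : ℕ) F z ∧
    derivSnd (derivSnd F) z ≤ δ / 2) hK fun θ hθ => ?_
  have h1 : ContinuousAt (derivSnd (derivSnd F)) ((θ, μs), ωs) :=
    ((hF θ hθ).derivSnd (k := 4)).derivSnd (k := 3) |>.continuousAt
  have h2 := h1.eventually_lt_const (show derivSnd (derivSnd F) ((θ, μs), ωs) < δ / 2 by
    have := hcurv θ hθ; linarith)
  exact ((hF θ hθ).eventually (by simp)).and (h2.mono fun z hz => hz.le)

/-- A critical point near the centre of the rectangle can be continued to the whole rectangle. -/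
theorem eventually_exists_crit {K : Set Θ} (hK : IsCompact K) {δ : ℝ} (hδ : δ < 0)
    (hF : ∀ θ ∈ K, ContDiffAt ℝ (5 : ℕ) F ((θ, μs), ωs))
    (hcurv : ∀ θ ∈ K, derivSnd (derivSnd F) ((θ, μs), ωs) ≤ δ) :
    ∀ᶠ ηω in 𝓝[>] (0 : ℝ), ∀ᶠ ημ in 𝓝[>] (0 : ℝ), ∀ θ ∈ K, ∀ μ₀ ∈ closedBall μs ημ,
      ∀ ω₀ ∈ closedBall ωs (ηω / 2), derivSnd F ((θ, μ₀), ω₀) = 0 →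
        ∀ μ ∈ closedBall μs ημ, ∃ ω ∈ ball ωs ηω, derivSnd F ((θ, μ), ω) = 0 := by
  filter_upwards [eventually_concaveRect hK hδ hF hcurv, self_mem_nhdsWithin] with ηω h hpos
  have hpos : 0 < ηω := hpos
  have hc : ∀ t ∈ closedBall ωs ηω, ∀ θ ∈ K,
      ContinuousAt (fun x => derivSnd F (x, t)) (θ, μs) := by
    intro t ht θ hθ
    obtain ⟨ημ, h1, h2⟩ := (h.and self_mem_nhdsWithin).exists
    have h3 : ContinuousAt (derivSnd F) ((θ, μs), t) :=
      ((h1 θ hθ μs (mem_closedBall_self (le_of_lt h2)) t ht).1.derivSnd (k := 4)).continuousAt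
    exact h3.comp (f := fun x : Θ × Par d => (x, t)) (by fun_prop)
  -- Each endpoint ωs ± ηω is at distance at least ηω/2 from ω₀, so slope δ/2 makes the derivative
  -- there at least -δηω/4 in modulus, with opposite signs at the two ends. Moving from μ₀ to μs to
  -- μ costs less than 2 · (-δηω/16), so the signs survive.
  have hunif : ∀ t ∈ closedBall ωs ηω, ∀ᶠ ημ in 𝓝[>] (0 : ℝ), ∀ ν ∈ closedBall μs ημ, ∀ θ ∈ K,
      |derivSnd F ((θ, ν), t) - derivSnd F ((θ, μs), t)| < -δ * ηω / 16 := by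
    intro t ht
    refine eventually_closedBall_of_eventually_nhds
      (hK.eventually_forall_of_forall_eventually (P := fun ν θ =>
        |derivSnd F ((θ, ν), t) - derivSnd F ((θ, μs), t)| < -δ * ηω / 16) fun θ hθ => ?_)
    have h1 : ContinuousAt (fun u : Par d × Θ => derivSnd F ((u.2, u.1), t)) (μs, θ) :=
      ContinuousAt.comp (g := fun x => derivSnd F (x, t)) (f := fun u : Par d × Θ => (u.2, u.1))
        (hc t ht θ hθ) (by fun_prop)
    have h2 : ContinuousAt (fun u : Par d × Θ => derivSnd F ((u.2, μs), t)) (μs, θ) :=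
      ContinuousAt.comp (g := fun x => derivSnd F (x, t)) (f := fun u : Par d × Θ => (u.2, μs))
        (hc t ht θ hθ) (by fun_prop)
    refine (h1.sub h2).abs.eventually_lt_const ?_
    simp only [Pi.sub_apply, sub_self, abs_zero]
    nlinarith
  have hb1 : ωs - ηω ∈ closedBall ωs ηω := by simp [abs_of_pos hpos]
  have hb2 : ωs + ηω ∈ closedBall ωs ηω := by simp [abs_of_pos hpos]
  filter_upwards [h, hunif _ hb1, hunif _ hb2] with ημ hR h1 h2 θ hθ μ₀ hμ₀ ω₀ hω₀ h0 μ hμ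
  rw [Real.closedBall_eq_Icc] at hω₀
  have hω₀' : ω₀ ∈ closedBall ωs ηω := by
    rw [Real.closedBall_eq_Icc]; constructor <;> linarith [hω₀.1, hω₀.2]
  have e1 := (hR θ hθ).deriv_sub_le hμ₀ hb1 hω₀' (by linarith [hω₀.1])
  have e2 := (hR θ hθ).deriv_sub_le hμ₀ hω₀' hb2 (by linarith [hω₀.2])
  have a1 := abs_lt.1 (h1 μ hμ θ hθ)
  have a2 := abs_lt.1 (h1 μ₀ hμ₀ θ hθ)
  have a3 := abs_lt.1 (h2 μ hμ θ hθ)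
  have a4 := abs_lt.1 (h2 μ₀ hμ₀ θ hθ)
  have e3 : 0 < derivSnd F ((θ, μ), ωs - ηω) := by nlinarith [hω₀.1]
  have e4 : derivSnd F ((θ, μ), ωs + ηω) < 0 := by nlinarith [hω₀.2]
  have hcont : ContinuousOn (fun t => derivSnd F ((θ, μ), t)) (Icc (ωs - ηω) (ωs + ηω)) :=
    fun t ht => ((hR θ hθ).hasDerivAt_two hμ
      (by rwa [Real.closedBall_eq_Icc])).continuousAt.continuousWithinAt
  obtain ⟨ω, hω, hω0⟩ := intermediate_value_Ioo' (by linarith) hcont ⟨e4, e3⟩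
  exact ⟨ω, by rwa [Real.ball_eq_Ioo], hω0⟩

/-- The implicit function theorem for the equation ∂F/∂ω = 0, nondegenerate because the second
derivative does not vanish. The equivalence says that near z the critical set is exactly the graph
of ψ. -/
theorem exists_implicit_crit {X : Type*} [NormedAddCommGroup X] [NormedSpace ℝ X] [CompleteSpace X]
    {F : X × ℝ → ℝ} {z : X × ℝ} (hF : ContDiffAt ℝ (5 : ℕ) F z) (h0 : derivSnd F z = 0)
    (h2 : derivSnd (derivSnd F) z ≠ 0) :
    ∃ ψ : X → ℝ, ψ z.1 = z.2 ∧ ContDiffAt ℝ (4 : ℕ) ψ z.1 ∧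
      ∀ᶠ y in 𝓝 z, derivSnd F y = 0 ↔ ψ y.1 = y.2 := by
  have h1 : ContDiffAt ℝ (4 : ℕ) (derivSnd F) z := hF.derivSnd
  have h3 := ContinuousLinearMap.isInvertible_of_apply_one_ne_zero
    (fderiv ℝ (derivSnd F) z ∘L .inr ℝ X ℝ) (by
      have := (hasDerivAt_slice (h1.differentiableAt (by simp))).deriv
      intro h4
      exact h2 (this.trans h4))
  have hn : ((4 : ℕ) : WithTop ℕ∞) ≠ 0 := by simp
  refine ⟨h1.implicitFunction hn h3, h1.implicitFunction_apply_self hn h3,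
    h1.contDiffAt_implicitFunction hn h3, ?_⟩
  filter_upwards [h1.eventually_apply_eq_iff_implicitFunction hn h3] with y hy
  rw [← hy, h0]

/-- For G of class C³ these derivatives are directional derivatives of G, continuous at x₀, so near
x₀ the sum of their moduli is at most its value at x₀ plus 1. -/
theorem exists_partialD_slice_bound {G : Θ × Par d → ℝ} {x₀ : Θ × Par d}
    (hG : ContDiffAt ℝ (3 : ℕ) G x₀) :
    ∃ γ > 0, ∀ᶠ x in 𝓝 x₀,
      (∀ q r, |partialD q (partialD r (fun ν => G (x.1, ν))) x.2| ≤ γ) ∧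
      (∀ q r l, |partialD q (partialD r (partialD l (fun ν => G (x.1, ν)))) x.2| ≤ γ) := by
  let e : Fin d → Θ × Par d := fun q => (0, EuclideanSpace.single q 1)
  have h2 : ∀ q r, ContDiffAt ℝ (1 : ℕ)
      (fun x => lineDeriv ℝ (fun x => lineDeriv ℝ G x (e r)) x (e q)) x₀ :=
    fun q r => (hG.lineDeriv (e r)).lineDeriv (e q)
  have h3 : ∀ q r l, ContDiffAt ℝ (0 : ℕ) (fun x => lineDeriv ℝ
      (fun x => lineDeriv ℝ (fun x => lineDeriv ℝ G x (e l)) x (e r)) x (e q)) x₀ :=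
    fun q r l => (h2 r l).lineDeriv (e q)
  have hp2 : ∀ q r (x : Θ × Par d), partialD q (partialD r (fun ν => G (x.1, ν))) x.2 =
      lineDeriv ℝ (fun x => lineDeriv ℝ G x (e r)) x (e q) := fun q r x => by
    rw [partialD_slice]
    exact congrFun (partialD_slice (fun y => lineDeriv ℝ G y (e r)) x.1 q) x.2
  have hp3 : ∀ q r l (x : Θ × Par d),
      partialD q (partialD r (partialD l (fun ν => G (x.1, ν)))) x.2 = lineDeriv ℝ
        (fun x => lineDeriv ℝ (fun x => lineDeriv ℝ G x (e l)) x (e r)) x (e q) :=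
    fun q r l x => by
      have h4 : partialD r (partialD l (fun ν => G (x.1, ν))) = fun ν => lineDeriv ℝ
          (fun x => lineDeriv ℝ G x (e l)) (x.1, ν) (e r) := by
        rw [partialD_slice]
        exact partialD_slice (fun y => lineDeriv ℝ G y (e l)) x.1 r
      rw [h4]
      exact congrFun (partialD_slice
        (fun y => lineDeriv ℝ (fun x => lineDeriv ℝ G x (e l)) y (e r)) x.1 q) x.2
  let N : Θ × Par d → ℝ := fun x =>
    ∑ i : Fin d × Fin d, |lineDeriv ℝ (fun x => lineDeriv ℝ G x (e i.2)) x (e i.1)| +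
    ∑ i : Fin d × Fin d × Fin d, |lineDeriv ℝ
      (fun x => lineDeriv ℝ (fun x => lineDeriv ℝ G x (e i.2.2)) x (e i.2.1)) x (e i.1)|
  have hN : ContinuousAt N x₀ :=
    ContinuousAt.add (tendsto_finsetSum _ fun i _ => (h2 i.1 i.2).continuousAt.abs)
      (tendsto_finsetSum _ fun i _ => (h3 i.1 i.2.1 i.2.2).continuousAt.abs)
  refine ⟨N x₀ + 1, by positivity, ?_⟩
  filter_upwards [hN.eventually_lt_const (lt_add_one (N x₀))] with x hx
  have t1 : 0 ≤ ∑ i : Fin d × Fin d,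
      |lineDeriv ℝ (fun x => lineDeriv ℝ G x (e i.2)) x (e i.1)| := by positivity
  have t2 : 0 ≤ ∑ i : Fin d × Fin d × Fin d, |lineDeriv ℝ
      (fun x => lineDeriv ℝ (fun x => lineDeriv ℝ G x (e i.2.2)) x (e i.2.1)) x (e i.1)| := by
    positivity
  refine ⟨fun q r => ?_, fun q r l => ?_⟩
  · rw [hp2]
    have := Finset.single_le_sum (s := Finset.univ)
      (f := fun i : Fin d × Fin d => |lineDeriv ℝ (fun x => lineDeriv ℝ G x (e i.2)) x (e i.1)|)
      (fun _ _ => abs_nonneg _) (Finset.mem_univ (q, r))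
    simp only [N] at hx ⊢
    linarith
  · rw [hp3]
    have := Finset.single_le_sum (s := Finset.univ)
      (f := fun i : Fin d × Fin d × Fin d => |lineDeriv ℝ
        (fun x => lineDeriv ℝ (fun x => lineDeriv ℝ G x (e i.2.2)) x (e i.2.1)) x (e i.1)|)
      (fun _ _ => abs_nonneg _) (Finset.mem_univ (q, r, l))
    simp only [N] at hx ⊢
    linarith

variable [CompleteSpace Θ]

/-- Continuity of w need not be assumed: the implicit branch through (μ, w μ) stays in the open
interval and critical near μ, and concavity allows only one critical frequency, so w agrees with it.
-/
theorem ConcaveRect.contDiffOn_branch (h : ConcaveRect F c μs ωs ημ ηω θ) (hc : c < 0)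
    (hw : ∀ μ ∈ closedBall μs ημ, w μ ∈ ball ωs ηω ∧ derivSnd F ((θ, μ), w μ) = 0) :
    ContDiffOn ℝ 3 w (closedBall μs ημ) := by
  intro μ hμ
  have hwμ := hw μ hμ
  have hR := h μ hμ (w μ) (ball_subset_closedBall hwμ.1)
  obtain ⟨ψ, hψ0, hψ, hiff⟩ := exists_implicit_crit hR.1 hwμ.2 (by linarith [hR.2])
  have hψμ : ContDiffAt ℝ 3 (fun ν => ψ (θ, ν)) μ :=
    (hψ.comp μ (f := fun ν => (θ, ν)) (contDiffAt_const.prodMk contDiffAt_id)).of_le (by norm_cast)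
  have hcont : Tendsto (fun ν => ((θ, ν), ψ (θ, ν))) (𝓝 μ) (𝓝 ((θ, μ), w μ)) := by
    have h1 : ContinuousAt (fun ν => ((θ, ν), ψ (θ, ν))) μ := by
      exact (continuousAt_const.prodMk continuousAt_id).prodMk hψμ.continuousAt
    have h2 := h1.tendsto
    simp only at hψ0
    rwa [hψ0] at h2
  have heq : w =ᶠ[𝓝[closedBall μs ημ] μ] fun ν => ψ (θ, ν) := by
    have h1 := hcont.eventually hiff
    have h2 : ∀ᶠ ν in 𝓝 μ, ψ (θ, ν) ∈ ball ωs ηω :=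
      ((continuous_snd.tendsto _).comp hcont).eventually (isOpen_ball.mem_nhds hwμ.1)
    filter_upwards [nhdsWithin_le_nhds h1, nhdsWithin_le_nhds h2, self_mem_nhdsWithin]
      with ν hν1 hν2 hν
    by_contra hne
    exact (h.lt_and_ne hc hν (ball_subset_closedBall (hw ν hν).1) (ball_subset_closedBall hν2)
      (hw ν hν).2 (Ne.symm hne)).2 (hν1.2 rfl)
  exact hψμ.contDiffWithinAt.congr_of_eventuallyEq_of_mem heq hμ

/-- Every continuous critical branch through a point near z₀ agrees there with the same implicit
function ψ, so its critical value is a slice of F(x, ψ x) and the bound does not depend on the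
branch. -/
theorem exists_partialD_bound_nhds {z₀ : (Θ × Par d) × ℝ} (hF : ContDiffAt ℝ (5 : ℕ) F z₀)
    (h0 : derivSnd F z₀ = 0) (h2 : derivSnd (derivSnd F) z₀ ≠ 0) :
    ∃ γ > 0, ∀ᶠ z in 𝓝 z₀, ∀ w : Par d → ℝ, ContinuousAt w z.1.2 → w z.1.2 = z.2 →
      (∀ᶠ ν in 𝓝 z.1.2, derivSnd F ((z.1.1, ν), w ν) = 0) →
      (∀ q r, |partialD q (partialD r (fun ν => F ((z.1.1, ν), w ν))) z.1.2| ≤ γ) ∧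
      (∀ q r l, |partialD q (partialD r (partialD l (fun ν => F ((z.1.1, ν), w ν)))) z.1.2| ≤ γ)
    := by
  obtain ⟨⟨θ₀, μ₀⟩, ω₀⟩ := z₀
  obtain ⟨ψ, hψ0, hψ, hiff⟩ := exists_implicit_crit hF h0 h2
  have hG : ContDiffAt ℝ (3 : ℕ) (fun x => F (x, ψ x)) (θ₀, μ₀) := by
    have h1 : ContDiffAt ℝ (4 : ℕ) F ((θ₀, μ₀), ψ (θ₀, μ₀)) := by
      simp only at hψ0
      rw [hψ0]; exact hF.of_le (by norm_cast)
    exact (h1.comp (θ₀, μ₀) (contDiffAt_id.prodMk hψ)).of_le (by norm_cast)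
  obtain ⟨γ, hγ, hb⟩ := exists_partialD_slice_bound hG
  refine ⟨γ, hγ, ?_⟩
  filter_upwards [(continuous_fst.tendsto ((θ₀, μ₀), ω₀)).eventually hb, hiff.eventually_nhds]
  rintro ⟨⟨θ, μ⟩, ω⟩ hz1 hz2 w hwc hw hwz
  simp only at hz1 hz2 hwc hw hwz ⊢
  have hcont : Tendsto (fun ν => ((θ, ν), w ν)) (𝓝 μ) (𝓝 ((θ, μ), ω)) := by
    have h1 : ContinuousAt (fun ν => ((θ, ν), w ν)) μ :=
      (continuousAt_const.prodMk continuousAt_id).prodMk hwc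
    have h2 := h1.tendsto
    rwa [hw] at h2
  have heq : (fun ν => F ((θ, ν), w ν)) =ᶠ[𝓝 μ] fun ν => F ((θ, ν), ψ (θ, ν)) := by
    filter_upwards [hcont.eventually hz2, hwz] with ν h1 h2
    rw [h1.1 h2]
  refine ⟨fun q r => ?_, fun q r l => ?_⟩
  · rw [(partialD_congr (partialD_congr heq r) q).eq_of_nhds]
    exact hz1.1 q r
  · rw [(partialD_congr (partialD_congr (partialD_congr heq l) r) q).eq_of_nhds]
    exact hz1.2 q r l

/-- The critical points over the smaller ball form a compact set, on which the local bounds combine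
into one. The smaller radius ensures that a branch is critical on a full neighbourhood of each μ
considered. -/
theorem exists_partialD_bound {K : Set Θ} (hK : IsCompact K) (hc : c < 0)
    (h : ∀ θ ∈ K, ConcaveRect F c μs ωs ημ ηω θ) {η' : ℝ} (hη' : η' < ημ) :
    ∃ γ > 0, ∀ θ ∈ K, ∀ w : Par d → ℝ, ContinuousOn w (closedBall μs ημ) →
      (∀ μ ∈ closedBall μs ημ, w μ ∈ closedBall ωs ηω ∧ derivSnd F ((θ, μ), w μ) = 0) →
      ∀ μ ∈ closedBall μs η',
        (∀ q r, |partialD q (partialD r (fun ν => F ((θ, ν), w ν))) μ| ≤ γ) ∧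
        (∀ q r l, |partialD q (partialD r (partialD l (fun ν => F ((θ, ν), w ν)))) μ| ≤ γ) := by
  let B : ℝ → (Θ × Par d) × ℝ → Prop := fun γ z =>
    ∀ w : Par d → ℝ, ContinuousAt w z.1.2 → w z.1.2 = z.2 →
      (∀ᶠ ν in 𝓝 z.1.2, derivSnd F ((z.1.1, ν), w ν) = 0) →
      (∀ q r, |partialD q (partialD r (fun ν => F ((z.1.1, ν), w ν))) z.1.2| ≤ γ) ∧
      (∀ q r l, |partialD q (partialD r (partialD l (fun ν => F ((z.1.1, ν), w ν)))) z.1.2| ≤ γ)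
  have hBmono : ∀ γ γ' z, γ ≤ γ' → B γ z → B γ' z := fun γ γ' z hle hB w h1 h2 h3 =>
    ⟨fun q r => ((hB w h1 h2 h3).1 q r).trans hle,
      fun q r l => ((hB w h1 h2 h3).2 q r l).trans hle⟩
  let Z : Set ((Θ × Par d) × ℝ) :=
    ((K ×ˢ closedBall μs η') ×ˢ closedBall ωs ηω) ∩ derivSnd F ⁻¹' {0}
  have hsub : closedBall μs η' ⊆ closedBall μs ημ := closedBall_subset_closedBall hη'.le
  have hZ : IsCompact Z := by
    have hc1 : IsCompact ((K ×ˢ closedBall μs η') ×ˢ closedBall ωs ηω) :=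
      (hK.prod (isCompact_closedBall _ _)).prod (isCompact_closedBall _ _)
    have hcont : ContinuousOn (derivSnd F) ((K ×ˢ closedBall μs η') ×ˢ closedBall ωs ηω) := by
      rintro ⟨⟨θ, μ⟩, ω⟩ ⟨⟨hθ, hμ⟩, hω⟩
      exact ((h θ hθ μ (hsub hμ) ω hω).1.derivSnd (k := 4)).continuousAt.continuousWithinAt
    exact hc1.of_isClosed_subset
      (hcont.preimage_isClosed_of_isClosed hc1.isClosed isClosed_singleton) inter_subset_left
  have hQ : ∃ γ > 0, ∀ z ∈ Z, B γ z := by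
    refine hZ.induction_on (p := fun T => ∃ γ > 0, ∀ z ∈ T, B γ z)
      ⟨1, one_pos, fun z hz => absurd hz (notMem_empty _)⟩ ?_ ?_ ?_
    · rintro s t hst ⟨γ, hγ, ht⟩
      exact ⟨γ, hγ, fun z hz => ht z (hst hz)⟩
    · rintro s t ⟨γ, hγ, hs⟩ ⟨γ', hγ', ht⟩
      refine ⟨max γ γ', lt_max_of_lt_left hγ, fun z hz => ?_⟩
      rcases hz with hz | hz
      · exact hBmono _ _ z (le_max_left _ _) (hs z hz)
      · exact hBmono _ _ z (le_max_right _ _) (ht z hz)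
    · rintro ⟨⟨θ₀, μ₀⟩, ω₀⟩ ⟨⟨⟨hθ, hμ⟩, hω⟩, h0⟩
      have hR := h θ₀ hθ μ₀ (hsub hμ) ω₀ hω
      obtain ⟨γ, hγ, hb⟩ := exists_partialD_bound_nhds hR.1 h0 (by linarith [hR.2])
      exact ⟨_, mem_nhdsWithin_of_mem_nhds hb, γ, hγ, fun z hz => hz⟩
  obtain ⟨γ, hγ, hγ'⟩ := hQ
  refine ⟨γ, hγ, fun θ hθ w hwc hw μ hμ => ?_⟩
  have hnhds : closedBall μs ημ ∈ 𝓝 μ :=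
    mem_of_superset (isOpen_ball.mem_nhds ((mem_closedBall.1 hμ).trans_lt hη'))
      ball_subset_closedBall
  refine hγ' ((θ, μ), w μ) ⟨⟨⟨hθ, hμ⟩, (hw μ (hsub hμ)).1⟩, (hw μ (hsub hμ)).2⟩ w
    (hwc.continuousAt hnhds) rfl ?_
  filter_upwards [hnhds] with ν hν using (hw ν hν).2

end Branch

/-! ### Hermite interpolation by projected pencils -/

section Interpolation

open scoped Matrix.Norms.L2Operator
open Asymptotics

variable {n m p r : ℕ}

theorem exists_mul_eq_of_colSpace_le {a b c : ℕ} {M : Matrix (Fin a) (Fin b) ℂ}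
    {V : Matrix (Fin a) (Fin c) ℂ} (h : colSpace M ≤ colSpace V) :
    ∃ Y : Matrix (Fin c) (Fin b) ℂ, V * Y = M := by
  have h1 : ∀ j, ∃ y, V *ᵥ y = M.col j := fun j => by
    have : M.col j ∈ colSpace V := h ⟨Pi.single j 1, by simp⟩
    exact this
  choose y hy using h1
  refine ⟨Matrix.of fun i j => y j i, ?_⟩
  ext i j
  exact congrFun (hy j) i

/-- Two curves of matrices through the same point have the same norm up to first order, if their
difference is of higher order on the range of the common matrix. -/
theorem norm_sq_sub_isLittleO {P Q : ℝ → Matrix (Fin p) (Fin m) ℂ}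
    (hP : DifferentiableAt ℝ P 0) (hQ : DifferentiableAt ℝ Q 0) (h0 : Q 0 = P 0)
    (h : (fun t => (P 0)ᴴ * (Q t - P t)) =o[𝓝 0] fun t : ℝ => t) :
    (fun t => ‖Q t‖ ^ 2 - ‖P t‖ ^ 2) =o[𝓝 0] fun t : ℝ => t := by
  have hsq : ∀ R : ℝ → Matrix (Fin p) (Fin m) ℂ, DifferentiableAt ℝ R 0 →
      (fun t => (R t - R 0)ᴴ * (R t - R 0)) =o[𝓝 0] fun t : ℝ => t := by
    intro R hR
    have h1 : (fun t => R t - R 0) =O[𝓝 0] fun t : ℝ => t := by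
      simpa using hR.isBigO_sub
    have h2 : (fun t => ‖R t - R 0‖ * ‖R t - R 0‖) =O[𝓝 0] fun t : ℝ => t * t :=
      h1.norm_left.mul h1.norm_left
    have h3 : (fun t : ℝ => t * t) =o[𝓝 0] fun t : ℝ => t := by
      simpa using (isLittleO_one_iff ℝ).2 (tendsto_id (α := ℝ) (x := 𝓝 0)) |>.mul_isBigO
        (isBigO_refl (fun t : ℝ => t) (𝓝 0))
    refine IsBigO.trans_isLittleO ?_ (h2.trans_isLittleO h3)
    refine IsBigO.of_bound 1 (Eventually.of_forall fun t => ?_)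
    rw [Matrix.l2_opNorm_conjTranspose_mul_self, one_mul]
    exact le_abs_self _
  have h4 : (fun t => (Q t - P t)ᴴ * P 0) =o[𝓝 0] fun t : ℝ => t := by
    refine h.norm_left.congr_left (fun t => ?_) |>.of_norm_left
    rw [← Matrix.l2_opNorm_conjTranspose, Matrix.conjTranspose_mul,
      Matrix.conjTranspose_conjTranspose]
  -- Expanding around P₀ = P(0) = Q(0): QᴴQ - PᴴP = P₀ᴴ(Q - P) + (Q - P)ᴴP₀ + (Q - P₀)ᴴ(Q - P₀) - (P
  -- - P₀)ᴴ(P - P₀), and each term is o(t).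
  have h5 : (fun t => (Q t)ᴴ * Q t - (P t)ᴴ * P t) =o[𝓝 0] fun t : ℝ => t := by
    refine (((h.add h4).add (hsq Q hQ)).sub (hsq P hP)).congr_left fun t => ?_
    rw [h0]
    simp only [Matrix.conjTranspose_sub, Matrix.sub_mul, Matrix.mul_sub]
    abel
  refine IsBigO.trans_isLittleO (IsBigO.of_bound 1 (Eventually.of_forall fun t => ?_)) h5
  rw [sq, sq, ← Matrix.l2_opNorm_conjTranspose_mul_self, ← Matrix.l2_opNorm_conjTranspose_mul_self,
    one_mul]
  exact abs_norm_sub_norm_le _ _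

/-- The transfer function of a pencil, in the variable `t`. -/
noncomputable def pencilTf (C : Matrix (Fin p) (Fin n) ℂ) (D G : Matrix (Fin n) (Fin n) ℂ)
    (B : Matrix (Fin n) (Fin m) ℂ) (t : ℝ) : Matrix (Fin p) (Fin m) ℂ :=
  C * (D + (t : ℂ) • G)⁻¹ * B

variable {C : Matrix (Fin p) (Fin n) ℂ} {D G : Matrix (Fin n) (Fin n) ℂ}
  {B : Matrix (Fin n) (Fin m) ℂ} {V W : Matrix (Fin n) (Fin r) ℂ}

theorem contDiffAt_pencil (D G : Matrix (Fin n) (Fin n) ℂ) :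
    ContDiffAt ℝ 1 (fun t : ℝ => D + (t : ℂ) • G) 0 :=
  contDiffAt_const.add ((Complex.ofRealCLM.contDiff.contDiffAt).smul contDiffAt_const)

theorem differentiableAt_pencilTf (hD : D.det ≠ 0) :
    DifferentiableAt ℝ (pencilTf C D G B) 0 := by
  have h1 := (contDiffAt_pencil D G).matrix_inv (by simpa using hD)
  exact ((contDiffAt_const.matrix_mul h1).matrix_mul contDiffAt_const).differentiableAt one_ne_zero

theorem pencilTf_conjTranspose (t : ℝ) :
    (pencilTf C D G B t)ᴴ = pencilTf Bᴴ Dᴴ Gᴴ Cᴴ t := by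
  simp [pencilTf, Matrix.conjTranspose_mul, Matrix.conjTranspose_nonsing_inv, Matrix.mul_assoc]

/-- A Petrov–Galerkin projection reproduces a solution lying in the trial space: if D⁻¹B = VY, then
WᴴB = (WᴴDV)Y, so the reduced solution is Y. -/
theorem mul_inv_mul_eq_of_right (hD : D.det ≠ 0) (hDr : (Wᴴ * D * V).det ≠ 0)
    {Y : Matrix (Fin r) (Fin m) ℂ} (hY : V * Y = D⁻¹ * B) :
    V * (Wᴴ * D * V)⁻¹ * (Wᴴ * B) = D⁻¹ * B := by
  have h1 : Wᴴ * B = (Wᴴ * D * V) * Y := by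
    rw [Matrix.mul_assoc, hY, ← Matrix.mul_assoc, Matrix.mul_assoc Wᴴ,
      Matrix.mul_nonsing_inv _ (isUnit_iff_ne_zero.2 hD), Matrix.mul_one]
  rw [h1, Matrix.mul_assoc, ← Matrix.mul_assoc _ _ Y,
    Matrix.nonsing_inv_mul _ (isUnit_iff_ne_zero.2 hDr), Matrix.one_mul, hY]

theorem pencilTf_interpolation (hD : D.det ≠ 0) (hDr : (Wᴴ * D * V).det ≠ 0)
    (hV : ∃ Y : Matrix (Fin r) (Fin m) ℂ, V * Y = D⁻¹ * B) :
    pencilTf (C * V) (Wᴴ * D * V) (Wᴴ * G * V) (Wᴴ * B) 0 = pencilTf C D G B 0 := by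
  obtain ⟨Y, hY⟩ := hV
  have := mul_inv_mul_eq_of_right hD hDr hY
  simp only [pencilTf, Complex.ofReal_zero, zero_smul, add_zero]
  rw [Matrix.mul_assoc C V, Matrix.mul_assoc C, this, Matrix.mul_assoc C]

/-- Let X = CD⁻¹B. The left hypothesis gives XᴴC = (WZ)ᴴD, so multiplying either transfer function
by Xᴴ gives (WZ)ᴴB minus t(WZ)ᴴG times its state, where the states are (D + tG)⁻¹B and its projected
counterpart. The states agree at t = 0, so the difference is o(t). To first order the norm sees
nothing beyond this product with Xᴴ, which is why an H-weighted left space suffices. -/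
theorem pencilTf_hermite (hD : D.det ≠ 0) (hDr : (Wᴴ * D * V).det ≠ 0)
    (hV : ∃ Y : Matrix (Fin r) (Fin m) ℂ, V * Y = D⁻¹ * B)
    (hW : ∃ Z : Matrix (Fin r) (Fin m) ℂ, W * Z = Dᴴ⁻¹ * Cᴴ * (C * D⁻¹ * B)) :
    (fun t => ‖pencilTf (C * V) (Wᴴ * D * V) (Wᴴ * G * V) (Wᴴ * B) t‖ ^ 2
      - ‖pencilTf C D G B t‖ ^ 2) =o[𝓝 0] fun t : ℝ => t := by
  refine norm_sq_sub_isLittleO (differentiableAt_pencilTf hD) (differentiableAt_pencilTf hDr)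
    (pencilTf_interpolation hD hDr hV) ?_
  obtain ⟨Y, hY⟩ := hV
  obtain ⟨Z, hZ⟩ := hW
  have hP0 : pencilTf C D G B 0 = C * D⁻¹ * B := by simp [pencilTf]
  have hDH : IsUnit Dᴴ.det := by
    rw [Matrix.det_conjTranspose]; exact isUnit_iff_ne_zero.2 (star_ne_zero.2 hD)
  have hZD : (W * Z)ᴴ * D = (C * D⁻¹ * B)ᴴ * C := by
    have h1 : Dᴴ * (W * Z) = Cᴴ * (C * D⁻¹ * B) := by
      rw [hZ, Matrix.mul_assoc Dᴴ⁻¹, ← Matrix.mul_assoc Dᴴ, Matrix.mul_nonsing_inv _ hDH,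
        Matrix.one_mul]
    have h2 := congrArg Matrix.conjTranspose h1
    rwa [Matrix.conjTranspose_mul, Matrix.conjTranspose_mul Cᴴ, Matrix.conjTranspose_conjTranspose,
      Matrix.conjTranspose_conjTranspose] at h2
  have hd1 := (contDiffAt_pencil D G).matrix_inv (by simpa using hD)
  have hd2 := (contDiffAt_pencil (Wᴴ * D * V) (Wᴴ * G * V)).matrix_inv (by simpa using hDr)
  have hdet1 : ∀ᶠ t : ℝ in 𝓝 0, (D + (t : ℂ) • G).det ≠ 0 :=
    (contDiffAt_pencil D G).matrix_det.continuousAt.eventually_ne (by simpa using hD)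
  have hdet2 : ∀ᶠ t : ℝ in 𝓝 0, (Wᴴ * D * V + (t : ℂ) • (Wᴴ * G * V)).det ≠ 0 :=
    (contDiffAt_pencil (Wᴴ * D * V) (Wᴴ * G * V)).matrix_det.continuousAt.eventually_ne
      (by simpa using hDr)
  -- Up to the factor -t, this is Xᴴ times the difference of the reduced and the full transfer
  -- function.
  let R : ℝ → Matrix (Fin m) (Fin m) ℂ := fun t => (W * Z)ᴴ * G *
    (V * (Wᴴ * D * V + (t : ℂ) • (Wᴴ * G * V))⁻¹ * (Wᴴ * B) - (D + (t : ℂ) • G)⁻¹ * B)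
  have hR : Tendsto R (𝓝 0) (𝓝 0) := by
    have h1 : ContDiffAt ℝ 1 R 0 :=
      contDiffAt_const.matrix_mul (((contDiffAt_const.matrix_mul hd2).matrix_mul
        contDiffAt_const).sub (hd1.matrix_mul contDiffAt_const))
    have h2 := h1.continuousAt.tendsto
    have h3 : R 0 = 0 := by
      simp only [R, Complex.ofReal_zero, zero_smul, add_zero]
      rw [mul_inv_mul_eq_of_right hD hDr hY, sub_self, Matrix.mul_zero]
    rwa [h3] at h2
  have h1 : (fun t : ℝ => t • R t) =o[𝓝 0] fun t : ℝ => t := by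
    simpa using (isBigO_refl (fun t : ℝ => t) (𝓝 0)).smul_isLittleO ((isLittleO_one_iff ℝ).2 hR)
  refine h1.neg_left.congr' ?_ EventuallyEq.rfl
  filter_upwards [hdet1, hdet2] with t ht1 ht2
  rw [hP0]
  generalize C * D⁻¹ * B = X at *
  have e1 : Xᴴ * pencilTf C D G B t
      = (W * Z)ᴴ * B - (t : ℂ) • ((W * Z)ᴴ * G * ((D + (t : ℂ) • G)⁻¹ * B)) := by
    have : Xᴴ * C = (W * Z)ᴴ * (D + (t : ℂ) • G) - (t : ℂ) • ((W * Z)ᴴ * G) := by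
      rw [Matrix.mul_add, Matrix.mul_smul, hZD, add_sub_cancel_right]
    rw [pencilTf, Matrix.mul_assoc C, ← Matrix.mul_assoc Xᴴ, this, Matrix.sub_mul, Matrix.smul_mul,
      Matrix.mul_assoc (W * Z)ᴴ, ← Matrix.mul_assoc (D + (t : ℂ) • G),
      Matrix.mul_nonsing_inv _ (isUnit_iff_ne_zero.2 ht1), Matrix.one_mul]
  have e2 : Xᴴ * pencilTf (C * V) (Wᴴ * D * V) (Wᴴ * G * V) (Wᴴ * B) t
      = (W * Z)ᴴ * B - (t : ℂ) • ((W * Z)ᴴ * G *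
        (V * (Wᴴ * D * V + (t : ℂ) • (Wᴴ * G * V))⁻¹ * (Wᴴ * B))) := by
    set Dr := Wᴴ * D * V + (t : ℂ) • (Wᴴ * G * V)
    have : Xᴴ * (C * V) = Zᴴ * Dr - (t : ℂ) • ((W * Z)ᴴ * G * V) := by
      rw [← Matrix.mul_assoc, ← hZD]
      simp only [Dr, Matrix.conjTranspose_mul, Matrix.mul_add, Matrix.mul_smul, Matrix.mul_assoc,
        add_sub_cancel_right]
    change Xᴴ * (C * V * Dr⁻¹ * (Wᴴ * B)) = _
    clear_value Dr
    rw [Matrix.mul_assoc (C * V), ← Matrix.mul_assoc Xᴴ, this, Matrix.sub_mul,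
      Matrix.smul_mul, Matrix.mul_assoc Zᴴ, ← Matrix.mul_assoc Dr,
      Matrix.mul_nonsing_inv _ (isUnit_iff_ne_zero.2 ht2), Matrix.one_mul, ← Matrix.mul_assoc,
      ← Matrix.conjTranspose_mul]
    simp only [Matrix.mul_assoc]
  rw [Matrix.mul_sub, e1, e2, sub_sub_sub_cancel_left, ← smul_sub, ← Matrix.mul_sub]
  simp only [R]
  rw [← smul_neg, ← Matrix.mul_neg, neg_sub]
  rfl

end Interpolation

/-! ### The reduced transfer function as a joint function of bases, parameter and frequency -/

section System

open scoped Matrix.Norms.L2Operator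
open Asymptotics

theorem contDiffAt_matrix_combination {d κ a b : ℕ} {f : Fin κ → Par d → ℝ}
    {μ : Par d} (hf : ∀ i, AnalyticAt ℝ (f i) μ) (K : Fin κ → Matrix (Fin a) (Fin b) ℝ)
    (N : WithTop ℕ∞) :
    ContDiffAt ℝ N (fun μ => (∑ i, f i μ • K i).map Complex.ofReal) μ := by
  rw [contDiffAt_matrix]
  intro i j
  simp only [Matrix.map_apply, Matrix.sum_apply, Matrix.smul_apply, smul_eq_mul]
  have h : ContDiffAt ℝ N (fun μ => ∑ k, f k μ * K k i j) μ :=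
    ContDiffAt.sum fun k _ => (hf k).contDiffAt.mul contDiffAt_const
  exact Complex.ofRealCLM.contDiff.contDiffAt.comp μ h

namespace ParamSystem

variable {d n m p r : ℕ} (S : ParamSystem d n m p)

theorem redD_eq (V W : Matrix (Fin n) (Fin r) ℂ) (μ : Par d) (s : ℂ) :
    S.redD V W μ s = Wᴴ * S.D μ s * V := by
  simp [redD, D, Matrix.mul_sub, Matrix.sub_mul]

/-- Makes the full system a member of the family of reduced ones, so that it needs no separate
smoothness theory. -/
theorem redD_one (μ : Par d) (s : ℂ) : S.redD 1 1 μ s = S.D μ s := by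
  simp [redD_eq]

theorem redH_one (μ : Par d) (s : ℂ) : S.redH (1 : Matrix (Fin n) (Fin n) ℂ) 1 μ s = S.H μ s := by
  simp [redH, H, redD_one]

theorem redSigma_one : S.redSigma (1 : Matrix (Fin n) (Fin n) ℂ) 1 = S.sigma := by
  funext μ ω; simp [redSigma, sigma, redH_one]

theorem redSigma2_one : S.redSigma2 (1 : Matrix (Fin n) (Fin n) ℂ) 1 = S.sigma2 := by
  funext μ ω; simp [redSigma2, sigma2, redH_one]

/-- `σ^{V,W}(μ, ω)` as a function of all variables. -/
noncomputable def redFun (r : ℕ)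
    (z : ((Matrix (Fin n) (Fin r) ℂ × Matrix (Fin n) (Fin r) ℂ) × Par d) × ℝ) : ℝ :=
  S.redSigma z.1.1.1 z.1.1.2 z.1.2 z.2

/-- The points at which `σ^{V,W}(μ, ω)` is a simple singular value of a well-defined matrix. -/
def redRegular (r : ℕ) (ε : ℝ)
    (z : ((Matrix (Fin n) (Fin r) ℂ × Matrix (Fin n) (Fin r) ℂ) × Par d) × ℝ) : Prop :=
  z.1.2 ∈ S.Ω ∧ (S.redD z.1.1.1 z.1.1.2 z.1.2 (Complex.I * z.2)).det ≠ 0 ∧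
    ε < S.redSigma z.1.1.1 z.1.1.2 z.1.2 z.2 - S.redSigma2 z.1.1.1 z.1.1.2 z.1.2 z.2

variable {z : ((Matrix (Fin n) (Fin r) ℂ × Matrix (Fin n) (Fin r) ℂ) × Par d) × ℝ}
  {N : WithTop ℕ∞} {μ : Par d}

theorem contDiffAt_E (hμ : μ ∈ S.Ω) : ContDiffAt ℝ N S.E μ :=
  contDiffAt_matrix_combination (fun i => S.f_analytic i μ hμ) S.Emat N

theorem contDiffAt_A (hμ : μ ∈ S.Ω) : ContDiffAt ℝ N S.A μ :=
  contDiffAt_matrix_combination (fun i => S.g_analytic i μ hμ) S.Amat N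

theorem contDiffAt_B (hμ : μ ∈ S.Ω) : ContDiffAt ℝ N S.B μ :=
  contDiffAt_matrix_combination (fun i => S.h_analytic i μ hμ) S.Bmat N

theorem contDiffAt_C (hμ : μ ∈ S.Ω) : ContDiffAt ℝ N S.C μ :=
  contDiffAt_matrix_combination (fun i => S.l_analytic i μ hμ) S.Cmat N

theorem contDiffAt_redD (hμ : z.1.2 ∈ S.Ω) :
    ContDiffAt ℝ N (fun z : ((Matrix (Fin n) (Fin r) ℂ × Matrix (Fin n) (Fin r) ℂ) × Par d) × ℝ =>
      S.redD z.1.1.1 z.1.1.2 z.1.2 (Complex.I * z.2)) z := by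
  have hV : ContDiffAt ℝ N (fun z : ((Matrix (Fin n) (Fin r) ℂ × Matrix (Fin n) (Fin r) ℂ) × Par d)
      × ℝ => z.1.1.1) z := by fun_prop
  have hW : ContDiffAt ℝ N (fun z : ((Matrix (Fin n) (Fin r) ℂ × Matrix (Fin n) (Fin r) ℂ) × Par d)
      × ℝ => z.1.1.2) z := by fun_prop
  have hμ' : ContDiffAt ℝ N (fun z : ((Matrix (Fin n) (Fin r) ℂ × Matrix (Fin n) (Fin r) ℂ) × Par d)
      × ℝ => z.1.2) z := by fun_prop
  have hs : ContDiffAt ℝ N (fun z : ((Matrix (Fin n) (Fin r) ℂ × Matrix (Fin n) (Fin r) ℂ) × Par d)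
      × ℝ => Complex.I * (z.2 : ℂ)) z :=
    contDiffAt_const.mul (Complex.ofRealCLM.contDiff.contDiffAt.comp z contDiffAt_snd)
  have hE := (S.contDiffAt_E (N := N) hμ).comp z hμ'
  have hA := (S.contDiffAt_A (N := N) hμ).comp z hμ'
  exact (hs.smul ((hW.matrix_conjTranspose.matrix_mul hE).matrix_mul hV)).sub
    ((hW.matrix_conjTranspose.matrix_mul hA).matrix_mul hV)

theorem contDiffAt_redH (hμ : z.1.2 ∈ S.Ω)
    (hD : (S.redD z.1.1.1 z.1.1.2 z.1.2 (Complex.I * z.2)).det ≠ 0) :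
    ContDiffAt ℝ N (fun z : ((Matrix (Fin n) (Fin r) ℂ × Matrix (Fin n) (Fin r) ℂ) × Par d) × ℝ =>
      S.redH z.1.1.1 z.1.1.2 z.1.2 (Complex.I * z.2)) z := by
  have hV : ContDiffAt ℝ N (fun z : ((Matrix (Fin n) (Fin r) ℂ × Matrix (Fin n) (Fin r) ℂ) × Par d)
      × ℝ => z.1.1.1) z := by fun_prop
  have hW : ContDiffAt ℝ N (fun z : ((Matrix (Fin n) (Fin r) ℂ × Matrix (Fin n) (Fin r) ℂ) × Par d)
      × ℝ => z.1.1.2) z := by fun_prop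
  have hμ' : ContDiffAt ℝ N (fun z : ((Matrix (Fin n) (Fin r) ℂ × Matrix (Fin n) (Fin r) ℂ) × Par d)
      × ℝ => z.1.2) z := by fun_prop
  have hB := (S.contDiffAt_B (N := N) hμ).comp z hμ'
  have hC := (S.contDiffAt_C (N := N) hμ).comp z hμ'
  exact ((hC.matrix_mul hV).matrix_mul ((S.contDiffAt_redD hμ).matrix_inv hD)).matrix_mul
    (hW.matrix_conjTranspose.matrix_mul hB)

theorem continuousAt_redSigma (hμ : z.1.2 ∈ S.Ω)
    (hD : (S.redD z.1.1.1 z.1.1.2 z.1.2 (Complex.I * z.2)).det ≠ 0) :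
    ContinuousAt (fun z : ((Matrix (Fin n) (Fin r) ℂ × Matrix (Fin n) (Fin r) ℂ) × Par d) × ℝ =>
      S.redSigma z.1.1.1 z.1.1.2 z.1.2 z.2) z :=
  continuous_sigMax.continuousAt.comp (S.contDiffAt_redH (N := 0) hμ hD).continuousAt

theorem continuousAt_redSigma2 (hμ : z.1.2 ∈ S.Ω)
    (hD : (S.redD z.1.1.1 z.1.1.2 z.1.2 (Complex.I * z.2)).det ≠ 0) :
    ContinuousAt (fun z : ((Matrix (Fin n) (Fin r) ℂ × Matrix (Fin n) (Fin r) ℂ) × Par d) × ℝ =>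
      S.redSigma2 z.1.1.1 z.1.1.2 z.1.2 z.2) z :=
  continuous_sigSnd.continuousAt.comp (S.contDiffAt_redH (N := 0) hμ hD).continuousAt

theorem eventually_det_redD_ne_zero (hμ : z.1.2 ∈ S.Ω)
    (hD : (S.redD z.1.1.1 z.1.1.2 z.1.2 (Complex.I * z.2)).det ≠ 0) :
    ∀ᶠ z : ((Matrix (Fin n) (Fin r) ℂ × Matrix (Fin n) (Fin r) ℂ) × Par d) × ℝ in 𝓝 z,
      z.1.2 ∈ S.Ω ∧ (S.redD z.1.1.1 z.1.1.2 z.1.2 (Complex.I * z.2)).det ≠ 0 := by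
  refine Filter.Eventually.and ?_
    ((S.contDiffAt_redD (N := 0) hμ).matrix_det.continuousAt.eventually_ne hD)
  exact (continuous_snd.comp continuous_fst).continuousAt.eventually (S.isOpen.mem_nhds hμ)

theorem redRegular.eventually {ε : ℝ} (h : S.redRegular r ε z) :
    ∀ᶠ y in 𝓝 z, S.redRegular r ε y := by
  have h1 := ((S.continuousAt_redSigma h.1 h.2.1).sub
    (S.continuousAt_redSigma2 h.1 h.2.1)).eventually_const_lt h.2.2
  filter_upwards [S.eventually_det_redD_ne_zero h.1 h.2.1, h1] with y hy hy' using
    ⟨hy.1, hy.2, hy'⟩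

theorem redRegular.contDiffAt {ε : ℝ} (hε : 0 ≤ ε) (h : S.redRegular r ε z) :
    ContDiffAt ℝ N (S.redFun r) z := by
  have h1 : S.redSigma2 z.1.1.1 z.1.1.2 z.1.2 z.2 < S.redSigma z.1.1.1 z.1.1.2 z.1.2 z.2 := by
    linarith [h.2.2]
  exact (contDiffAt_sigMax h1).comp z (S.contDiffAt_redH h.1 h.2.1)

theorem iteratedDeriv_two_redSigma (V W : Matrix (Fin n) (Fin r) ℂ) (μ : Par d) (ω : ℝ) :
    iteratedDeriv 2 (S.redSigma V W μ) ω = derivSnd (derivSnd (S.redFun r)) (((V, W), μ), ω) := by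
  rw [iteratedDeriv_succ, iteratedDeriv_one]
  rfl

/-! ### Interpolation -/

theorem D_add (μ : Par d) (ω t : ℝ) :
    S.D μ (Complex.I * (ω + t : ℝ)) = S.D μ (Complex.I * ω) + (t : ℂ) • (Complex.I • S.E μ) := by
  simp only [D, smul_smul]
  push_cast
  rw [mul_add, add_smul, mul_comm (t : ℂ)]
  abel

theorem H_add (μ : Par d) (ω t : ℝ) : S.H μ (Complex.I * (ω + t : ℝ)) =
    pencilTf (S.C μ) (S.D μ (Complex.I * ω)) (Complex.I • S.E μ) (S.B μ) t := by
  rw [H, D_add, pencilTf]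

theorem redH_add (V W : Matrix (Fin n) (Fin r) ℂ) (μ : Par d) (ω t : ℝ) :
    S.redH V W μ (Complex.I * (ω + t : ℝ)) = pencilTf (S.C μ * V)
      (Wᴴ * S.D μ (Complex.I * ω) * V) (Wᴴ * (Complex.I • S.E μ) * V) (Wᴴ * S.B μ) t := by
  rw [redH, redD_eq, D_add, pencilTf]
  simp only [Matrix.mul_add, Matrix.add_mul, Matrix.mul_smul, Matrix.smul_mul]

variable {V W : Matrix (Fin n) (Fin r) ℂ} {ω : ℝ}

theorem exists_right_factor (hm : ¬ p < m) (hV : S.expandV μ ω ≤ colSpace V) :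
    ∃ Y : Matrix (Fin r) (Fin m) ℂ, V * Y = (S.D μ (Complex.I * ω))⁻¹ * S.B μ := by
  rw [expandV, if_neg hm] at hV
  exact exists_mul_eq_of_colSpace_le hV

theorem exists_left_factor (hp : ¬ m < p) (hW : S.expandW μ ω ≤ colSpace W) :
    ∃ Z : Matrix (Fin r) (Fin p) ℂ, W * Z = (S.D μ (Complex.I * ω))ᴴ⁻¹ * (S.C μ)ᴴ := by
  rw [expandW, if_neg hp] at hW
  exact exists_mul_eq_of_colSpace_le hW

theorem exists_left_factor_mul (hW : S.expandW μ ω ≤ colSpace W) :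
    ∃ Z : Matrix (Fin r) (Fin m) ℂ,
      W * Z = (S.D μ (Complex.I * ω))ᴴ⁻¹ * (S.C μ)ᴴ * S.H μ (Complex.I * ω) := by
  by_cases h : m < p
  · rw [expandW, if_pos h] at hW
    exact exists_mul_eq_of_colSpace_le hW
  · obtain ⟨Z, hZ⟩ := S.exists_left_factor h hW
    exact ⟨Z * S.H μ (Complex.I * ω), by rw [← Matrix.mul_assoc, hZ]⟩

/-- For m ≤ p the right space holds all of D⁻¹B and the left one at least the H-weighted matrix. For
p < m the roles are exchanged, and the same argument applies to the conjugate transposes, which have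
the same norms. -/
theorem redH_hermite (hV : S.expandV μ ω ≤ colSpace V) (hW : S.expandW μ ω ≤ colSpace W)
    (hD : (S.D μ (Complex.I * ω)).det ≠ 0) (hDr : (S.redD V W μ (Complex.I * ω)).det ≠ 0) :
    S.redH V W μ (Complex.I * ω) = S.H μ (Complex.I * ω) ∧
    (fun t : ℝ => S.redSigma V W μ (ω + t) ^ 2 - S.sigma μ (ω + t) ^ 2) =o[𝓝 0] fun t : ℝ => t := by
  rw [redD_eq] at hDr
  have e1 := S.H_add μ ω
  have e2 := S.redH_add V W μ ω
  have e10 := e1 0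
  have e20 := e2 0
  rw [add_zero] at e10 e20
  simp only [redSigma, sigma, sigMax_eq_norm]
  by_cases h : p < m
  · have hD' : (S.D μ (Complex.I * ω))ᴴ.det ≠ 0 := by
      rw [Matrix.det_conjTranspose]; exact star_ne_zero.2 hD
    have hDr' : (Vᴴ * (S.D μ (Complex.I * ω))ᴴ * W).det ≠ 0 := by
      have : Vᴴ * (S.D μ (Complex.I * ω))ᴴ * W = (Wᴴ * S.D μ (Complex.I * ω) * V)ᴴ := by
        simp [Matrix.conjTranspose_mul, Matrix.mul_assoc]
      rw [this, Matrix.det_conjTranspose]; exact star_ne_zero.2 hDr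
    have hY := S.exists_left_factor (by omega) hW
    have hconj : ∀ t, (pencilTf (S.C μ * V) (Wᴴ * S.D μ (Complex.I * ω) * V)
        (Wᴴ * (Complex.I • S.E μ) * V) (Wᴴ * S.B μ) t)ᴴ = pencilTf ((S.B μ)ᴴ * W)
        (Vᴴ * (S.D μ (Complex.I * ω))ᴴ * W) (Vᴴ * (Complex.I • S.E μ)ᴴ * W)
        (Vᴴ * (S.C μ)ᴴ) t := by
      intro t
      rw [pencilTf_conjTranspose]
      simp only [Matrix.conjTranspose_mul, Matrix.conjTranspose_conjTranspose, Matrix.mul_assoc]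
    constructor
    · rw [e10, e20, ← Matrix.conjTranspose_inj, hconj, pencilTf_conjTranspose]
      exact pencilTf_interpolation hD' hDr' hY
    · have hZ : ∃ Z : Matrix (Fin r) (Fin p) ℂ, V * Z = (S.D μ (Complex.I * ω))ᴴᴴ⁻¹ * (S.B μ)ᴴᴴ *
          ((S.B μ)ᴴ * (S.D μ (Complex.I * ω))ᴴ⁻¹ * (S.C μ)ᴴ) := by
        rw [expandV, if_pos h] at hV
        obtain ⟨Z, hZ⟩ := exists_mul_eq_of_colSpace_le hV
        refine ⟨Z, hZ.trans ?_⟩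
        simp only [H, Matrix.conjTranspose_mul, Matrix.conjTranspose_conjTranspose,
          Matrix.conjTranspose_nonsing_inv, Matrix.mul_assoc]
      have := pencilTf_hermite (G := (Complex.I • S.E μ)ᴴ) hD' hDr' hY hZ
      refine this.congr_left fun t => ?_
      rw [e1, e2, ← Matrix.l2_opNorm_conjTranspose (pencilTf (S.C μ * V) _ _ _ t), hconj,
        ← Matrix.l2_opNorm_conjTranspose (pencilTf (S.C μ) _ _ _ t), pencilTf_conjTranspose]
  · have hY := S.exists_right_factor h hV
    have hZ := S.exists_left_factor_mul hW
    constructor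
    · rw [e10, e20]
      exact pencilTf_interpolation hD hDr hY
    · refine (pencilTf_hermite (G := Complex.I • S.E μ) hD hDr hY hZ).congr_left fun t => ?_
      rw [e1, e2]

/-- The squares of the two norms agree to first order, so their derivatives agree; the common factor
2σ ≠ 0 cancels. -/
theorem hasDerivAt_redSigma_zero (hV : S.expandV μ ω ≤ colSpace V)
    (hW : S.expandW μ ω ≤ colSpace W) (hD : (S.D μ (Complex.I * ω)).det ≠ 0)
    (hDr : (S.redD V W μ (Complex.I * ω)).det ≠ 0) (hpos : S.sigma μ ω ≠ 0)
    (hσ : HasDerivAt (S.sigma μ) 0 ω) (hred : DifferentiableAt ℝ (S.redSigma V W μ) ω) :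
    HasDerivAt (S.redSigma V W μ) 0 ω := by
  obtain ⟨h1, h2⟩ := S.redH_hermite hV hW hD hDr
  have h0 : S.redSigma V W μ ω = S.sigma μ ω := by rw [redSigma, h1, sigma]
  have h3 : HasDerivAt (fun x => S.redSigma V W μ x ^ 2 - S.sigma μ x ^ 2) 0 ω := by
    rw [hasDerivAt_iff_isLittleO_nhds_zero]
    refine h2.congr_left fun t => ?_
    simp [h0]
  have h4 := (hred.hasDerivAt.pow 2).sub (hσ.pow 2)
  have h5 := h3.unique h4
  have h6 : deriv (S.redSigma V W μ) ω = 0 := by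
    rw [h0] at h5
    simpa [hpos] using h5.symm
  rw [← h6]
  exact hred.hasDerivAt

end ParamSystem

end System

/-! ### Compact families of reduced systems -/

section Compactness

open scoped Matrix.Norms.L2Operator

instance matrix_properSpace {a b : ℕ} : ProperSpace (Matrix (Fin a) (Fin b) ℂ) :=
  FiniteDimensional.proper ℂ _

/-- Orthonormal columns are independent. This leaves finitely many sizes r, hence finitely many
compact families. -/
theorem le_of_conjTranspose_mul_self_eq_one {a b : ℕ} {V : Matrix (Fin a) (Fin b) ℂ}
    (h : Vᴴ * V = 1) : b ≤ a := by
  have h1 : Function.Injective V.mulVecLin := fun x y hxy => by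
    have := congrArg (Vᴴ *ᵥ ·) hxy
    simpa [Matrix.mulVec_mulVec, h] using this
  simpa using LinearMap.finrank_le_finrank_of_injective h1

namespace ParamSystem

variable {d n m p : ℕ} (S : ParamSystem d n m p) (μs : Par d) (ωs : ℝ)

/-- Pairs of orthonormal bases for which the reduced pencil is bounded from below at
`(μs, iωs)`. -/
def reducers (β : ℝ) (r : ℕ) : Set (Matrix (Fin n) (Fin r) ℂ × Matrix (Fin n) (Fin r) ℂ) :=
  {θ | θ.1ᴴ * θ.1 = 1 ∧ θ.2ᴴ * θ.2 = 1 ∧ ∀ x : EuclideanSpace ℂ (Fin r),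
    β * ‖x‖ ≤ ‖Matrix.toEuclideanLin (S.redD θ.1 θ.2 μs (Complex.I * ωs)) x‖}

/-- Members of `reducers` with a gap between the two largest singular values of the reduced
transfer function, and a negative second derivative of the largest one. -/
def gapReducers (β ε δ : ℝ) (r : ℕ) :
    Set (Matrix (Fin n) (Fin r) ℂ × Matrix (Fin n) (Fin r) ℂ) :=
  {θ | θ ∈ S.reducers μs ωs β r ∧
    2 * ε ≤ S.redSigma θ.1 θ.2 μs ωs - S.redSigma2 θ.1 θ.2 μs ωs ∧
    derivSnd (derivSnd (S.redFun r)) ((θ, μs), ωs) ≤ δ}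

theorem norm_le_of_conjTranspose_mul_self_eq_one {r : ℕ} {V : Matrix (Fin n) (Fin r) ℂ}
    (h : Vᴴ * V = 1) : ‖V‖ ≤ ‖(1 : Matrix (Fin r) (Fin r) ℂ)‖ + 1 := by
  have h1 := Matrix.l2_opNorm_conjTranspose_mul_self V
  rw [h] at h1
  nlinarith [norm_nonneg V, sq_nonneg (‖V‖ - 1)]

variable {μs ωs} {β ε δ : ℝ} {r : ℕ}

/-- Orthonormality bounds the norms, and the lower bound on the pencil, stated vector by vector, is
an intersection of closed conditions. -/
theorem isCompact_reducers : IsCompact (S.reducers μs ωs β r) := by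
  refine Metric.isCompact_of_isClosed_isBounded ?_ ?_
  · have h1 : Continuous fun θ : Matrix (Fin n) (Fin r) ℂ × Matrix (Fin n) (Fin r) ℂ =>
        S.redD θ.1 θ.2 μs (Complex.I * ωs) := by
      unfold redD
      have h2 : Continuous fun θ : Matrix (Fin n) (Fin r) ℂ × Matrix (Fin n) (Fin r) ℂ => θ.2ᴴ :=
        continuous_snd.matrix_conjTranspose
      exact (((h2.matrix_mul continuous_const).matrix_mul continuous_fst).const_smul
        (Complex.I * (ωs : ℂ))).sub
        ((h2.matrix_mul continuous_const).matrix_mul continuous_fst)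
    have h3 : ∀ x : EuclideanSpace ℂ (Fin r), Continuous fun M : Matrix (Fin r) (Fin r) ℂ =>
        Matrix.toEuclideanLin M x := fun x =>
      ((LinearMap.applyₗ x).comp (Matrix.toEuclideanLin (𝕜 := ℂ) (m := Fin r)
        (n := Fin r)).toLinearMap).continuous_of_finiteDimensional
    simp only [reducers, ofPred_and, ofPred_forall]
    refine IsClosed.inter ?_ (IsClosed.inter ?_ (isClosed_iInter fun x => ?_))
    · exact isClosed_eq (continuous_fst.matrix_conjTranspose.matrix_mul continuous_fst)
        continuous_const
    · exact isClosed_eq (continuous_snd.matrix_conjTranspose.matrix_mul continuous_snd)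
        continuous_const
    · exact isClosed_le continuous_const ((h3 x).comp h1).norm
  · refine (Metric.isBounded_closedBall (x := (0 : Matrix (Fin n) (Fin r) ℂ × _))
      (r := ‖(1 : Matrix (Fin r) (Fin r) ℂ)‖ + 1)).subset fun θ hθ => ?_
    rw [mem_closedBall_zero_iff, Prod.norm_def, max_le_iff]
    exact ⟨norm_le_of_conjTranspose_mul_self_eq_one hθ.1,
      norm_le_of_conjTranspose_mul_self_eq_one hθ.2.1⟩

theorem det_ne_zero_of_mem_reducers (hβ : 0 < β)
    {θ : Matrix (Fin n) (Fin r) ℂ × Matrix (Fin n) (Fin r) ℂ} (hθ : θ ∈ S.reducers μs ωs β r) :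
    (S.redD θ.1 θ.2 μs (Complex.I * ωs)).det ≠ 0 :=
  det_ne_zero_of_le_norm hβ _ hθ.2.2

theorem redRegular_of_mem_gapReducers (hμs : μs ∈ S.Ω) (hβ : 0 < β) (hε : 0 < ε)
    {θ : Matrix (Fin n) (Fin r) ℂ × Matrix (Fin n) (Fin r) ℂ}
    (hθ : θ ∈ S.gapReducers μs ωs β ε δ r) : S.redRegular r ε ((θ, μs), ωs) :=
  ⟨hμs, S.det_ne_zero_of_mem_reducers hβ hθ.1, by
    have := hθ.2.1
    simp only
    linarith⟩

/-- The order of the cuts matters: the gap is continuous on all of `reducers`, whereas continuity of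
the second derivative is available only after the gap condition has been imposed. -/
theorem isCompact_gapReducers (hμs : μs ∈ S.Ω) (hβ : 0 < β) (hε : 0 < ε) :
    IsCompact (S.gapReducers μs ωs β ε δ r) := by
  let g : (Matrix (Fin n) (Fin r) ℂ × Matrix (Fin n) (Fin r) ℂ) → ℝ :=
    fun θ => S.redSigma θ.1 θ.2 μs ωs - S.redSigma2 θ.1 θ.2 μs ωs
  have hslice : Continuous fun θ : Matrix (Fin n) (Fin r) ℂ × Matrix (Fin n) (Fin r) ℂ =>
      ((θ, μs), ωs) := by fun_prop
  have hg : ContinuousOn g (S.reducers μs ωs β r) := fun θ hθ => by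
    have hdet := S.det_ne_zero_of_mem_reducers hβ hθ
    have h1 := S.continuousAt_redSigma (z := ((θ, μs), ωs)) hμs hdet
    have h2 := S.continuousAt_redSigma2 (z := ((θ, μs), ωs)) hμs hdet
    exact ((h1.sub h2).comp (f := fun θ => ((θ, μs), ωs)) hslice.continuousAt).continuousWithinAt
  have h1 : IsCompact (S.reducers μs ωs β r ∩ g ⁻¹' Ici (2 * ε)) :=
    S.isCompact_reducers.of_isClosed_subset
      (hg.preimage_isClosed_of_isClosed S.isCompact_reducers.isClosed isClosed_Ici)
      inter_subset_left
  have hd : ContinuousOn (fun θ => derivSnd (derivSnd (S.redFun r)) ((θ, μs), ωs))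
      (S.reducers μs ωs β r ∩ g ⁻¹' Ici (2 * ε)) := fun θ hθ => by
    have hreg : S.redRegular r ε ((θ, μs), ωs) :=
      ⟨hμs, S.det_ne_zero_of_mem_reducers hβ hθ.1, by
        have : 2 * ε ≤ g θ := hθ.2
        simp only [g] at this ⊢
        linarith⟩
    have h2 : ContDiffAt ℝ (2 : ℕ) (S.redFun r) ((θ, μs), ωs) := hreg.contDiffAt S hε.le
    have h3 := (h2.derivSnd (k := 1)).derivSnd (k := 0) |>.continuousAt
    exact (h3.comp (f := fun θ => ((θ, μs), ωs)) hslice.continuousAt).continuousWithinAt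
  have h2 := h1.of_isClosed_subset
    (hd.preimage_isClosed_of_isClosed h1.isClosed (isClosed_Iic (a := δ))) inter_subset_left
  convert h2 using 1
  ext θ
  simp only [gapReducers, mem_ofPred_eq, mem_inter_iff, mem_preimage, mem_Ici, mem_Iic, g]
  tauto

/-- The gap of a reduced function near `(μs, ωs)` is inherited by the point `(μs, ωs)`. -/
theorem eventually_gap_of_gap (hμs : μs ∈ S.Ω) (hβ : 0 < β) (hε : 0 < ε) :
    ∀ᶠ v : Par d × ℝ in 𝓝 (μs, ωs), ∀ θ ∈ S.reducers μs ωs β r,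
      (S.redD θ.1 θ.2 v.1 (Complex.I * v.2)).det ≠ 0 ∧
      (3 * ε ≤ S.redSigma θ.1 θ.2 v.1 v.2 - S.redSigma2 θ.1 θ.2 v.1 v.2 →
        2 * ε ≤ S.redSigma θ.1 θ.2 μs ωs - S.redSigma2 θ.1 θ.2 μs ωs) := by
  let P : Par d × ℝ → Matrix (Fin n) (Fin r) ℂ × Matrix (Fin n) (Fin r) ℂ → Prop := fun v θ =>
    (S.redD θ.1 θ.2 v.1 (Complex.I * v.2)).det ≠ 0 ∧
      (3 * ε ≤ S.redSigma θ.1 θ.2 v.1 v.2 - S.redSigma2 θ.1 θ.2 v.1 v.2 →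
        2 * ε ≤ S.redSigma θ.1 θ.2 μs ωs - S.redSigma2 θ.1 θ.2 μs ωs)
  suffices key : ∀ θ ∈ S.reducers μs ωs β r, ∀ᶠ u : (Par d × ℝ) × _ in 𝓝 ((μs, ωs), θ),
      P u.1 u.2 from S.isCompact_reducers.eventually_forall_of_forall_eventually key
  intro θ hθ
  have hdet := S.det_ne_zero_of_mem_reducers hβ hθ
  have hg : ContinuousAt (fun z : ((Matrix (Fin n) (Fin r) ℂ × Matrix (Fin n) (Fin r) ℂ) × Par d)
      × ℝ => S.redSigma z.1.1.1 z.1.1.2 z.1.2 z.2 - S.redSigma2 z.1.1.1 z.1.1.2 z.1.2 z.2)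
      ((θ, μs), ωs) :=
    (S.continuousAt_redSigma (z := ((θ, μs), ωs)) hμs hdet).sub
      (S.continuousAt_redSigma2 (z := ((θ, μs), ωs)) hμs hdet)
  have t1 : Tendsto (fun u : (Par d × ℝ) × (Matrix (Fin n) (Fin r) ℂ × Matrix (Fin n) (Fin r) ℂ) =>
      ((u.2, u.1.1), u.1.2)) (𝓝 ((μs, ωs), θ)) (𝓝 ((θ, μs), ωs)) :=
    Continuous.tendsto (by fun_prop) ((μs, ωs), θ)
  have t2 : Tendsto (fun u : (Par d × ℝ) × (Matrix (Fin n) (Fin r) ℂ × Matrix (Fin n) (Fin r) ℂ) =>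
      ((u.2, μs), ωs)) (𝓝 ((μs, ωs), θ)) (𝓝 ((θ, μs), ωs)) :=
    Continuous.tendsto (by fun_prop) ((μs, ωs), θ)
  -- The gaps at the moving point and at (μs, ωs), for the same varying bases, have a common limit;
  -- eventually they differ by less than ε, which is the loss from 3ε to 2ε.
  have h1 := (hg.tendsto.comp t1).sub (hg.tendsto.comp t2)
  rw [sub_self] at h1
  have h2 := h1.eventually (gt_mem_nhds hε)
  have h3 := t1.eventually (S.eventually_det_redD_ne_zero (z := ((θ, μs), ωs)) hμs hdet)
  filter_upwards [h2, h3] with u hu hu'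
  refine ⟨hu'.2, fun h => ?_⟩
  simp only [Function.comp_apply] at hu
  linarith

end ParamSystem

end Compactness

/-! ### Rational functions on the right half-plane -/

section HalfPlane

open Polynomial

theorem eventually_eval_ne_zero {Q : ℂ[X]} (hQ : Q ≠ 0) (s v : ℂ) (hv : v ≠ 0) :
    ∀ᶠ t : ℝ in 𝓝[>] 0, Q.eval (s + t * v) ≠ 0 := by
  have hfin : {t : ℝ | Q.eval (s + t * v) = 0}.Finite := by
    refine Set.Finite.of_finite_image (f := fun t : ℝ => s + (t : ℂ) * v) ?_ ?_
    · refine (Q.rootSet_finite ℂ).subset ?_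
      rintro _ ⟨t, ht, rfl⟩
      rw [mem_rootSet]
      exact ⟨hQ, by simpa using ht⟩
    · intro a _ b _ hab
      simpa [hv] using hab
  have h1 : ({t : ℝ | Q.eval (s + t * v) = 0} \ {0})ᶜ ∈ 𝓝 (0 : ℝ) :=
    (hfin.subset sdiff_subset).isClosed.isOpen_compl.mem_nhds (by simp)
  filter_upwards [nhdsWithin_le_nhds h1, self_mem_nhdsWithin] with t ht ht0 h0
  exact ht ⟨h0, ne_of_gt ht0⟩

/-- A short segment leaving s avoids the finitely many zeros of gQ; there g cancels, and continuity
carries the bound to s even if s itself is such a zero. -/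
theorem norm_eval_le_of_direction {P Q g : ℂ[X]} (hg : g ≠ 0) (hQ : Q ≠ 0) {M : ℝ} {s v : ℂ}
    (hv : v ≠ 0)
    (h : ∀ t : ℝ, 0 < t → (g * Q).eval (s + t * v) ≠ 0 →
      ‖(g * P).eval (s + t * v) / (g * Q).eval (s + t * v)‖ ≤ M) :
    ‖P.eval s‖ ≤ M * ‖Q.eval s‖ := by
  have hcont : Tendsto (fun t : ℝ => s + (t : ℂ) * v) (𝓝[>] 0) (𝓝 s) := by
    have : Continuous fun t : ℝ => s + (t : ℂ) * v := by fun_prop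
    simpa using (this.tendsto 0).mono_left nhdsWithin_le_nhds
  have h1 : Tendsto (fun t : ℝ => ‖P.eval (s + (t : ℂ) * v)‖) (𝓝[>] 0) (𝓝 ‖P.eval s‖) :=
    ((P.continuous.norm).tendsto s).comp hcont
  have h2 : Tendsto (fun t : ℝ => M * ‖Q.eval (s + (t : ℂ) * v)‖) (𝓝[>] 0)
      (𝓝 (M * ‖Q.eval s‖)) :=
    ((Q.continuous.norm).tendsto s).comp hcont |>.const_mul M
  refine le_of_tendsto_of_tendsto h1 h2 ?_
  filter_upwards [eventually_eval_ne_zero (mul_ne_zero hg hQ) s v hv, self_mem_nhdsWithin]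
    with t ht ht0
  have h3 := h t ht0 ht
  rw [eval_mul] at ht
  have hgt := left_ne_zero_of_mul ht
  have hQt := right_ne_zero_of_mul ht
  rw [eval_mul, eval_mul, mul_div_mul_left _ _ hgt, norm_div, div_le_iff₀ (norm_pos_iff.2 hQt)] at h3
  exact h3

/-- A rational function that is bounded on the open right half-plane is bounded there by its
supremum on the imaginary axis. -/
theorem norm_div_le_of_imaginary_axis {P Q : ℂ[X]} (hQ : Q ≠ 0) {M c : ℝ}
    (hM : ∀ s : ℂ, 0 < s.re → Q.eval s ≠ 0 → ‖P.eval s / Q.eval s‖ ≤ M)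
    (hc : ∀ ω : ℝ, Q.eval (Complex.I * ω) ≠ 0 →
      ‖P.eval (Complex.I * ω) / Q.eval (Complex.I * ω)‖ ≤ c)
    {s : ℂ} (hs : 0 < s.re) (hs0 : Q.eval s ≠ 0) : ‖P.eval s / Q.eval s‖ ≤ c := by
  obtain ⟨P', hP'⟩ := EuclideanDomain.gcd_dvd_left P Q
  obtain ⟨Q', hQ'⟩ := EuclideanDomain.gcd_dvd_right P Q
  have hcop : IsCoprime P' Q' := by
    have hb := EuclideanDomain.gcd_eq_gcd_ab P Q
    set g := EuclideanDomain.gcd P Q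
    have hg : g ≠ 0 := fun h => hQ (by rw [hQ', h, zero_mul])
    refine ⟨EuclideanDomain.gcdA P Q, EuclideanDomain.gcdB P Q, mul_left_cancel₀ hg ?_⟩
    calc g * (EuclideanDomain.gcdA P Q * P' + EuclideanDomain.gcdB P Q * Q')
        = (g * P') * EuclideanDomain.gcdA P Q + (g * Q') * EuclideanDomain.gcdB P Q := by ring
      _ = g * 1 := by rw [← hP', ← hQ', mul_one]; exact hb.symm
  generalize EuclideanDomain.gcd P Q = g at hP' hQ'
  subst hP' hQ'
  have hg : g ≠ 0 := left_ne_zero_of_mul hQ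
  have hQ'0 : Q' ≠ 0 := right_ne_zero_of_mul hQ
  have hb : ∀ z : ℂ, 0 ≤ z.re → ‖P'.eval z‖ ≤ M * ‖Q'.eval z‖ := fun z hz =>
    norm_eval_le_of_direction hg hQ'0 one_ne_zero fun t ht h0 => hM _ (by simp; linarith) h0
  have hax : ∀ ω : ℝ, ‖P'.eval (Complex.I * ω)‖ ≤ c * ‖Q'.eval (Complex.I * ω)‖ := fun ω =>
    norm_eval_le_of_direction hg hQ'0 Complex.I_ne_zero fun t ht h0 => by
      have e : Complex.I * ω + t * Complex.I = Complex.I * ((ω + t : ℝ) : ℂ) := by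
        push_cast; ring
      rw [e] at h0 ⊢
      exact hc _ h0
  -- The bound would make a zero of Q' in the closed half-plane a zero of P' too, against
  -- coprimality; so the reduced fraction has no pole there.
  have hne : ∀ z : ℂ, 0 ≤ z.re → Q'.eval z ≠ 0 := fun z hz h0 => by
    have h1 := hb z hz
    rw [h0, norm_zero, mul_zero, norm_le_zero_iff] at h1
    obtain ⟨a, b, hab⟩ := hcop
    have := congrArg (eval z) hab
    simp [h0, h1] at this
  have hf : ∀ z : ℂ, 0 ≤ z.re → ‖P'.eval z / Q'.eval z‖ ≤ M := fun z hz => by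
    rw [norm_div, div_le_iff₀ (norm_pos_iff.2 (hne z hz))]
    exact hb z hz
  rw [eval_mul, eval_mul, mul_div_mul_left _ _ (left_ne_zero_of_mul (by rwa [eval_mul] at hs0))]
  -- The function is bounded, so the growth condition holds with exponent 1 < 2 and constant 0.
  refine PhragmenLindelof.right_half_plane_of_bounded_on_real
    (f := fun z => P'.eval z / Q'.eval z) ?_ ⟨1, by norm_num, 0, ?_⟩ ?_ ?_ hs.le
  · refine DifferentiableOn.diffContOnCl ?_
    have hcl : closure {z : ℂ | 0 < z.re} ⊆ {z : ℂ | 0 ≤ z.re} :=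
      closure_minimal (fun z (hz : 0 < z.re) => show (0 : ℝ) ≤ z.re from hz.le)
        (isClosed_le continuous_const Complex.continuous_re)
    exact fun z hz => (P'.differentiable.differentiableAt.div Q'.differentiable.differentiableAt
      (hne z (hcl hz))).differentiableWithinAt
  · refine Asymptotics.IsBigO.of_bound M (eventually_inf_principal.2
      (Eventually.of_forall fun z hz => ?_))
    simpa using hf z (le_of_lt hz)
  · refine isBoundedUnder_of_eventually_le (a := M) ?_
    filter_upwards [eventually_ge_atTop 0] with x hx
    exact hf x (by simpa using hx)
  · intro ω
    have h1 := hax ω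
    rw [mul_comm] at h1
    rw [norm_div, div_le_iff₀ (norm_pos_iff.2 (hne _ (by simp)))]
    exact h1

end HalfPlane

/-! ### The H∞-norm as a maximum over the imaginary axis -/

section HinfNorm

open scoped Matrix.Norms.L2Operator
open Polynomial

variable {d n m p : ℕ} (S : ParamSystem d n m p)

/-- Every matrix element of the transfer function of a pencil is a rational function. -/
theorem exists_polynomial_transfer (E A : Matrix (Fin n) (Fin n) ℂ) (B : Matrix (Fin n) (Fin m) ℂ)
    (C : Matrix (Fin p) (Fin n) ℂ) :
    ∃ Q : ℂ[X], (∀ s, Q.eval s = (s • E - A).det) ∧ ∀ (u : Fin p → ℂ) (v : Fin m → ℂ),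
      ∃ P : ℂ[X], ∀ s, (s • E - A).det ≠ 0 →
        P.eval s / Q.eval s = u ⬝ᵥ ((C * (s • E - A)⁻¹ * B) *ᵥ v) := by
  let Dp : Matrix (Fin n) (Fin n) ℂ[X] := (X : ℂ[X]) • E.map Polynomial.C - A.map Polynomial.C
  have hDp : ∀ s : ℂ, (evalRingHom s).mapMatrix Dp = s • E - A := fun s => by
    ext i j; simp [Dp]; ring
  have hdet : ∀ s, Dp.det.eval s = (s • E - A).det := fun s => by
    rw [← hDp, ← RingHom.map_det]; rfl
  refine ⟨Dp.det, hdet, fun u v => ?_⟩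
  -- Cramer's rule: the inverse is the adjugate over the determinant, and both are polynomial in s.
  let Np : Matrix (Fin p) (Fin m) ℂ[X] := C.map Polynomial.C * Dp.adjugate * B.map Polynomial.C
  have hNp : ∀ s i j, (Np i j).eval s = (C * (s • E - A).adjugate * B) i j := fun s i j => by
    rw [← hDp, ← RingHom.map_adjugate]
    simp [Np, Matrix.mul_apply, eval_finsetSum]
  refine ⟨∑ i, ∑ j, Polynomial.C (u i) * (Np i j * Polynomial.C (v j)), fun s hs => ?_⟩
  rw [hdet, Matrix.inv_def, Ring.inverse_eq_inv', Matrix.mul_smul, Matrix.smul_mul,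
    Matrix.smul_mulVec, dotProduct_smul, smul_eq_mul, div_eq_inv_mul]
  congr 1
  simp only [eval_finsetSum, eval_mul, eval_C, hNp, dotProduct, Matrix.mulVec, Finset.mul_sum]

namespace ParamSystem

variable {S} {μ : Par d}

/-- The inverse of a singular matrix is 0 by convention, so singular points satisfy every upper
bound by a nonnegative number. -/
theorem H_eq_zero {s : ℂ} (h : (S.D μ s).det = 0) : S.H μ s = 0 := by
  rw [H, Matrix.nonsing_inv_apply_not_isUnit _ (by simp [h])]
  simp

/-- The scalar half-plane bound is applied to the rational functions ⟨u, H(s)v⟩ with u, v fixed;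
taking u = H(s)v afterwards recovers the operator norm. -/
theorem sigMax_H_le (h : S.InHinf μ) {c : ℝ} (hc : ∀ ω : ℝ, S.sigma μ ω ≤ c) {s : ℂ}
    (hs : 0 < s.re) : sigMax (S.H μ s) ≤ c := by
  have hc0 : 0 ≤ c := (sigMax_nonneg _).trans (hc 0)
  by_cases hdet : (S.D μ s).det = 0
  · rw [H_eq_zero hdet, sigMax_eq_norm, norm_zero]
    exact hc0
  obtain ⟨Q, hQ, hP⟩ := exists_polynomial_transfer (S.E μ) (S.A μ) (S.B μ) (S.C μ)
  have hQ0 : Q ≠ 0 := by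
    rintro rfl
    exact hdet (by rw [D, ← hQ, eval_zero])
  have hM : ∀ s : ℂ, 0 < s.re → ‖S.H μ s‖ ≤ (S.hinfENorm μ).toReal := fun s hs => by
    rw [← sigMax_eq_norm]
    exact (ENNReal.ofReal_le_iff_le_toReal h.2.ne).1
      (le_iSup (fun s : {s : ℂ // 0 < s.re} => ENNReal.ofReal (sigMax (S.H μ s))) ⟨s, hs⟩)
  have hbil : ∀ (s : ℂ) (u : EuclideanSpace ℂ (Fin p)) (v : EuclideanSpace ℂ (Fin m)),
      star u.ofLp ⬝ᵥ (S.H μ s *ᵥ v.ofLp) = inner ℂ u (Matrix.toEuclideanLin (S.H μ s) v) := by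
    intro s u v
    rw [EuclideanSpace.inner_eq_star_dotProduct, dotProduct_comm]
    rfl
  have hop : ∀ (s : ℂ) (v : EuclideanSpace ℂ (Fin m)),
      ‖Matrix.toEuclideanLin (S.H μ s) v‖ ≤ ‖S.H μ s‖ * ‖v‖ := fun s v => by
    rw [Matrix.l2_opNorm_def]
    exact (LinearMap.toContinuousLinearMap (Matrix.toEuclideanLin (S.H μ s))).le_opNorm v
  have key : ∀ (u : EuclideanSpace ℂ (Fin p)) (v : EuclideanSpace ℂ (Fin m)),
      ‖inner ℂ u (Matrix.toEuclideanLin (S.H μ s) v)‖ ≤ c * (‖u‖ * ‖v‖) := by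
    intro u v
    obtain ⟨P, hP⟩ := hP (star u.ofLp) v.ofLp
    have hP' : ∀ s, Q.eval s ≠ 0 →
        P.eval s / Q.eval s = inner ℂ u (Matrix.toEuclideanLin (S.H μ s) v) := fun s hs => by
      rw [hP s (by rwa [← hQ]), ← hbil]
      rfl
    have hbound : ∀ (s : ℂ) (b : ℝ), ‖S.H μ s‖ ≤ b → Q.eval s ≠ 0 →
        ‖P.eval s / Q.eval s‖ ≤ b * (‖u‖ * ‖v‖) := fun s b hb hs => by
      rw [hP' s hs]
      calc _ ≤ ‖u‖ * ‖Matrix.toEuclideanLin (S.H μ s) v‖ := norm_inner_le_norm _ _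
        _ ≤ ‖u‖ * (b * ‖v‖) := by
          gcongr
          exact (hop s v).trans (by gcongr)
        _ = b * (‖u‖ * ‖v‖) := by ring
    have hQs : Q.eval s ≠ 0 := by rw [hQ]; exact hdet
    rw [← hP' s hQs]
    exact norm_div_le_of_imaginary_axis hQ0 (fun s hs => hbound s _ (hM s hs))
      (fun ω => hbound _ c (by rw [← sigMax_eq_norm]; exact hc ω)) hs hQs
  rw [sigMax_eq_norm, Matrix.l2_opNorm_def]
  refine ContinuousLinearMap.opNorm_le_bound _ hc0 fun v => ?_
  change ‖Matrix.toEuclideanLin (S.H μ s) v‖ ≤ c * ‖v‖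
  have h1 := key (Matrix.toEuclideanLin (S.H μ s) v) v
  rw [inner_self_eq_norm_sq_to_K] at h1
  simp only [norm_pow, RCLike.norm_ofReal, abs_norm] at h1
  rcases (norm_nonneg (Matrix.toEuclideanLin (S.H μ s) v)).eq_or_lt with h0 | h0
  · rw [← h0]; positivity
  · exact le_of_mul_le_mul_left (by nlinarith) h0

/-- By the maximum principle, the `H∞`-norm is the maximum over the imaginary axis. -/
theorem hinfNorm_eq (h : S.InHinf μ) {w : ℝ} (hD : (S.D μ (Complex.I * w)).det ≠ 0)
    (hmax : ∀ ω, S.sigma μ ω ≤ S.sigma μ w) : S.hinfNorm μ = S.sigma μ w := by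
  have h0 : 0 ≤ S.sigma μ w := sigMax_nonneg _
  have h1 : S.hinfENorm μ ≤ ENNReal.ofReal (S.sigma μ w) :=
    iSup_le fun s => ENNReal.ofReal_le_ofReal (sigMax_H_le h hmax s.2)
  refine le_antisymm (ENNReal.toReal_le_of_le_ofReal h0 h1) ?_
  -- For the reverse inequality, iw is approached horizontally from inside the half-plane.
  have hc : ContinuousAt (fun s : ℂ => sigMax (S.H μ s)) (Complex.I * w) := by
    have h2 : ContDiffAt ℝ 0 (fun s : ℂ => S.D μ s) (Complex.I * w) :=
      (contDiffAt_id.smul contDiffAt_const).sub contDiffAt_const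
    have h3 := (contDiffAt_const (c := S.C μ)).matrix_mul (h2.matrix_inv hD)
      |>.matrix_mul (contDiffAt_const (c := S.B μ))
    exact continuous_sigMax.continuousAt.comp h3.continuousAt
  have ht : Tendsto (fun t : ℝ => Complex.I * w + (t : ℂ)) (𝓝[>] 0) (𝓝 (Complex.I * w)) := by
    have : Continuous fun t : ℝ => Complex.I * w + (t : ℂ) := by fun_prop
    simpa using (this.tendsto 0).mono_left nhdsWithin_le_nhds
  refine le_of_tendsto (hc.tendsto.comp ht) ?_
  filter_upwards [self_mem_nhdsWithin] with t ht
  have ht' : 0 < (Complex.I * w + (t : ℂ)).re := by simpa using ht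
  exact (ENNReal.ofReal_le_iff_le_toReal h.2.ne).1
    (le_iSup (fun s : {s : ℂ // 0 < s.re} => ENNReal.ofReal (sigMax (S.H μ s))) ⟨_, ht'⟩)

end ParamSystem

end HinfNorm

/-! ### Localization of the maximizing frequencies -/

section MaximalFrequency

open scoped Matrix.Norms.L2Operator

namespace ParamSystem

variable {d n m p : ℕ} (S : ParamSystem d n m p)

theorem map_star_mul {a b c : ℕ} (M : Matrix (Fin a) (Fin b) ℂ) (N : Matrix (Fin b) (Fin c) ℂ) :
    (M * N).map star = M.map star * N.map star := by
  ext i j; simp [Matrix.mul_apply]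

theorem map_star_inv {a : ℕ} (M : Matrix (Fin a) (Fin a) ℂ) :
    (M⁻¹).map star = (M.map star)⁻¹ := by
  have h : ∀ N : Matrix (Fin a) (Fin a) ℂ, N.map star = Nᴴᵀ := fun N => by ext i j; rfl
  rw [h, h, Matrix.conjTranspose_nonsing_inv, Matrix.transpose_nonsing_inv]

theorem map_star_ofReal {a b : ℕ} (M : Matrix (Fin a) (Fin b) ℝ) :
    (M.map Complex.ofReal).map star = M.map Complex.ofReal := by
  ext i j; simp

/-- The coefficient matrices are real, so conjugation acts on s alone; on the imaginary axis it
changes the sign of ω. -/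
theorem H_star (μ : Par d) (s : ℂ) : (S.H μ s).map star = S.H μ (star s) := by
  have hD : (S.D μ s).map star = S.D μ (star s) := by
    have hE := map_star_ofReal (∑ i, S.f i μ • S.Emat i)
    have hA := map_star_ofReal (∑ i, S.g i μ • S.Amat i)
    ext i j
    have h1 := congrFun (congrFun hE i) j
    have h2 := congrFun (congrFun hA i) j
    simp only [Matrix.map_apply] at h1 h2
    simp only [D, E, A, Matrix.map_apply, Matrix.sub_apply, Matrix.smul_apply, smul_eq_mul,
      star_sub, star_mul', h1, h2]
  rw [H, H, map_star_mul, map_star_mul, map_star_inv, hD]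
  simp only [C, B, map_star_ofReal]

theorem sigma_neg (μ : Par d) (ω : ℝ) : S.sigma μ (-ω) = S.sigma μ ω := by
  rw [sigma, sigma, ← sigMax_map_conj (S.H μ (Complex.I * ω)), H_star]
  congr 2
  simp

variable {S} {μ : Par d} {ω : ℝ}

theorem continuousAt_sigma (h : (S.D μ (Complex.I * ω)).det ≠ 0) :
    ContinuousAt (S.sigma μ) ω := by
  have h1 : ContDiffAt ℝ 0 (fun ω : ℝ => S.D μ (Complex.I * ω)) ω :=
    ((contDiffAt_const.mul (Complex.ofRealCLM.contDiff.contDiffAt)).smul contDiffAt_const).sub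
      contDiffAt_const
  have h2 := (contDiffAt_const (c := S.C μ)).matrix_mul (h1.matrix_inv h)
    |>.matrix_mul (contDiffAt_const (c := S.B μ))
  exact continuous_sigMax.continuousAt.comp h2.continuousAt

theorem sigmaExt_coe (h : (S.D μ (Complex.I * ω)).det ≠ 0) :
    S.sigmaExt μ (ω : OnePoint ℝ) = S.sigma μ ω := by
  have hpre : ((↑) : ℝ → OnePoint ℝ) ⁻¹' {(ω : OnePoint ℝ)}ᶜ = {ω}ᶜ := by
    ext x; simp
  rw [sigmaExt, OnePoint.nhdsWithin_coe, comap_map OnePoint.coe_injective, hpre]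
  exact ((continuousAt_sigma h).tendsto.mono_left nhdsWithin_le_nhds).limUnder_eq

theorem sigma_eq_zero (h : (S.D μ (Complex.I * ω)).det = 0) : S.sigma μ ω = 0 := by
  rw [sigma, H_eq_zero h, sigMax_eq_norm, norm_zero]

variable {μs : Par d} {ωs : ℝ}

theorem sigma_le_of_sigmaExt_le (hmax : ∀ x : OnePoint ℝ, S.sigmaExt μs x ≤ S.sigma μs ωs)
    (ω : ℝ) : S.sigma μs ω ≤ S.sigma μs ωs := by
  by_cases h : (S.D μs (Complex.I * ω)).det = 0
  · rw [sigma_eq_zero h]; exact sigMax_nonneg _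
  · rw [← sigmaExt_coe h]; exact hmax _

/-- Away from `±ωs`, the function `σ(μ, ·)` stays below `σ(μ, ωs)` for all `μ` close to `μs`. -/
theorem eventually_sigma_lt
    (hcont : ∀ x : OnePoint ℝ,
      ContinuousAt (fun z : Par d × OnePoint ℝ => S.sigmaExt z.1 z.2) (μs, x))
    (hmax : ∀ x : OnePoint ℝ, S.sigmaExt μs x ≤ S.sigma μs ωs)
    (huniq : ∀ x : OnePoint ℝ, S.sigmaExt μs x = S.sigma μs ωs →
      x = (ωs : OnePoint ℝ) ∨ x = ((-ωs : ℝ) : OnePoint ℝ))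
    (hpos : 0 < S.sigma μs ωs) (hσ : ContinuousAt (fun μ => S.sigma μ ωs) μs) {η : ℝ} (hη : 0 < η) :
    ∀ᶠ μ in 𝓝 μs, ∀ ω : ℝ, ω ∉ ball ωs η → ω ∉ ball (-ωs) η → S.sigma μ ω < S.sigma μ ωs := by
  -- This set contains ∞ and is closed in the one-point compactification, hence compact; frequencies
  -- running to infinity are thereby controlled.
  let T : Set (OnePoint ℝ) := ((↑) '' ball ωs η ∪ (↑) '' ball (-ωs) η)ᶜ
  have hT : IsCompact T :=
    ((OnePoint.isOpenEmbedding_coe.isOpenMap _ isOpen_ball).union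
      (OnePoint.isOpenEmbedding_coe.isOpenMap _ isOpen_ball)).isClosed_compl.isCompact
  have h1 : ∀ᶠ μ in 𝓝 μs, ∀ x ∈ T, S.sigmaExt μ x < S.sigma μ ωs := by
    refine hT.eventually_forall_of_forall_eventually fun x hx => ?_
    have hlt : S.sigmaExt μs x < S.sigma μs ωs := by
      refine lt_of_le_of_ne (hmax x) fun he => hx ?_
      rcases huniq x he with h | h
      · exact Or.inl ⟨ωs, mem_ball_self hη, h.symm⟩
      · exact Or.inr ⟨-ωs, mem_ball_self hη, h.symm⟩
    have h2 : ContinuousAt (fun z : Par d × OnePoint ℝ => S.sigma z.1 ωs) (μs, x) :=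
      ContinuousAt.comp (g := fun μ => S.sigma μ ωs) (f := Prod.fst) hσ continuousAt_fst
    exact (hcont x).eventually_lt h2 hlt
  filter_upwards [h1, hσ.eventually_const_lt hpos] with μ hμ hμ0 ω ho1 ho2
  by_cases h : (S.D μ (Complex.I * ω)).det = 0
  · rwa [sigma_eq_zero h]
  · rw [← sigmaExt_coe h]
    refine hμ _ fun hmem => ?_
    rcases hmem with ⟨y, hy, hyω⟩ | ⟨y, hy, hyω⟩
    · exact ho1 (OnePoint.coe_injective hyω ▸ hy)
    · exact ho2 (OnePoint.coe_injective hyω ▸ hy)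

/-! ### Branches of maximizers -/

variable (S) {δ ε ημ ηω : ℝ} {r : ℕ}

/-- Strict concavity leaves one critical frequency per μ, so pointwise choice already determines the
branch, its value at μ₀, its uniqueness and the maximizing property. Smoothness then follows from
the implicit function theorem. -/
theorem exists_branch {θ : Matrix (Fin n) (Fin r) ℂ × Matrix (Fin n) (Fin r) ℂ} (hδ : δ < 0)
    (hε : 0 ≤ ε) (hR : ConcaveRect (S.redFun r) (δ / 2) μs ωs ημ ηω θ)
    (hreg : ∀ μ ∈ closedBall μs ημ, ∀ ω ∈ closedBall ωs ηω, S.redRegular r ε ((θ, μ), ω))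
    {μ₀ : Par d} {ω₀ : ℝ} (hμ₀ : μ₀ ∈ closedBall μs ημ) (hω₀ : ω₀ ∈ closedBall ωs ηω)
    (h0 : derivSnd (S.redFun r) ((θ, μ₀), ω₀) = 0)
    (hex : ∀ μ ∈ closedBall μs ημ, ∃ ω ∈ ball ωs ηω, derivSnd (S.redFun r) ((θ, μ), ω) = 0) :
    ∃ w : Par d → ℝ,
      (∀ μ ∈ closedBall μs ημ,
        w μ ∈ closedBall ωs ηω ∧ derivSnd (S.redFun r) ((θ, μ), w μ) = 0) ∧
      IsCritBranch (S.redSigma θ.1 θ.2) μs ωs ημ ηω μ₀ ω₀ w ∧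
      ContDiffOn ℝ 3 w (ball μs ημ) ∧
      (∀ w', IsCritBranch (S.redSigma θ.1 θ.2) μs ωs ημ ηω μ₀ ω₀ w' →
        EqOn w' w (closedBall μs ημ)) ∧
      (∀ μ ∈ closedBall μs ημ,
        iteratedDeriv 2 (S.redSigma θ.1 θ.2 μ) (w μ) ≤ δ / 2 ∧
        ε ≤ S.redSigma θ.1 θ.2 μ (w μ) - S.redSigma2 θ.1 θ.2 μ (w μ) ∧
        ∀ ω ∈ closedBall ωs ηω, ω ≠ w μ →
          S.redSigma θ.1 θ.2 μ ω < S.redSigma θ.1 θ.2 μ (w μ) ∧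
          ¬ HasDerivAt (S.redSigma θ.1 θ.2 μ) 0 ω) ∧
      ContDiffOn ℝ 3 (fun μ => S.redSigma θ.1 θ.2 μ (w μ)) (ball μs ημ) := by
  have hδ2 : δ / 2 < 0 := by linarith
  choose! w hw using hex
  have hwc : ∀ μ ∈ closedBall μs ημ,
      w μ ∈ closedBall ωs ηω ∧ derivSnd (S.redFun r) ((θ, μ), w μ) = 0 :=
    fun μ hμ => ⟨ball_subset_closedBall (hw μ hμ).1, (hw μ hμ).2⟩
  have hsmooth : ContDiffOn ℝ 3 w (closedBall μs ημ) := hR.contDiffOn_branch hδ2 hw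
  have huniq : ∀ μ ∈ closedBall μs ημ, ∀ ω ∈ closedBall ωs ηω,
      derivSnd (S.redFun r) ((θ, μ), ω) = 0 → ω = w μ := fun μ hμ ω hω hd => by
    by_contra hne
    exact (hR.lt_and_ne hδ2 hμ (hwc μ hμ).1 hω (hwc μ hμ).2 hne).2 hd
  refine ⟨w, hwc, ⟨hsmooth.continuousOn, fun μ hμ => (hwc μ hμ).1, hμ₀,
    (huniq μ₀ hμ₀ ω₀ hω₀ h0).symm, fun μ hμ => ?_⟩, hsmooth.mono ball_subset_closedBall,
    fun w' hw' μ hμ => huniq μ hμ _ (hw'.maps hμ) (hw'.crit μ hμ).deriv, fun μ hμ => ⟨?_, ?_, ?_⟩,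
    fun μ hμ => ?_⟩
  · have := hR.hasDerivAt hμ (hwc μ hμ).1
    rw [(hwc μ hμ).2] at this
    exact this
  · rw [iteratedDeriv_two_redSigma]
    exact (hR μ hμ _ (hwc μ hμ).1).2
  · exact (hreg μ hμ _ (hwc μ hμ).1).2.2.le
  · intro ω hω hne
    obtain ⟨h1, h2⟩ := hR.lt_and_ne hδ2 hμ (hwc μ hμ).1 hω (hwc μ hμ).2 hne
    exact ⟨h1, fun hd => h2 hd.deriv⟩
  · have hμ' := ball_subset_closedBall hμ
    have h1 : ContDiffAt ℝ 3 (S.redFun r) ((θ, μ), w μ) :=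
      (hreg μ hμ' _ (hwc μ hμ').1).contDiffAt S hε
    have h2 : ContDiffWithinAt ℝ 3 (fun μ => ((θ, μ), w μ)) (ball μs ημ) μ :=
      (contDiffWithinAt_const.prodMk contDiffWithinAt_id).prodMk
        (hsmooth.mono ball_subset_closedBall μ hμ)
    exact ContDiffAt.comp_contDiffWithinAt (g := S.redFun r) (f := fun μ => ((θ, μ), w μ)) μ h1 h2

/-- A rectangle on which the branches of all reduced functions are controlled. -/
structure BranchRect (K : Set (Matrix (Fin n) (Fin r) ℂ × Matrix (Fin n) (Fin r) ℂ)) (δ ε : ℝ)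
    (μs : Par d) (ωs ημ ηω : ℝ) : Prop where
  concave : ∀ θ ∈ K, ConcaveRect (S.redFun r) (δ / 2) μs ωs ημ ηω θ
  regular : ∀ θ ∈ K, ∀ μ ∈ closedBall μs ημ, ∀ ω ∈ closedBall ωs ηω,
    S.redRegular r ε ((θ, μ), ω)
  exists_crit : ∀ θ ∈ K, ∀ μ₀ ∈ closedBall μs ημ, ∀ ω₀ ∈ closedBall ωs (ηω / 2),
    derivSnd (S.redFun r) ((θ, μ₀), ω₀) = 0 →
      ∀ μ ∈ closedBall μs ημ, ∃ ω ∈ ball ωs ηω, derivSnd (S.redFun r) ((θ, μ), ω) = 0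

theorem eventually_branchRect {β : ℝ} (hμs : μs ∈ S.Ω) (hδ : δ < 0) (hβ : 0 < β) (hε : 0 < ε)
    (r : ℕ) : ∀ᶠ ηω in 𝓝[>] (0 : ℝ), ∀ᶠ ημ in 𝓝[>] (0 : ℝ),
      S.BranchRect (S.gapReducers μs ωs β ε δ r) δ ε μs ωs ημ ηω := by
  have hK : IsCompact (S.gapReducers μs ωs β ε δ r) := S.isCompact_gapReducers hμs hβ hε
  have hreg : ∀ θ ∈ S.gapReducers μs ωs β ε δ r, S.redRegular r ε ((θ, μs), ωs) :=
    fun θ hθ => S.redRegular_of_mem_gapReducers hμs hβ hε hθ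
  have hF : ∀ θ ∈ S.gapReducers μs ωs β ε δ r,
      ContDiffAt ℝ (5 : ℕ) (S.redFun r) ((θ, μs), ωs) := fun θ hθ => (hreg θ hθ).contDiffAt S hε.le
  have hcurv : ∀ θ ∈ S.gapReducers μs ωs β ε δ r,
      derivSnd (derivSnd (S.redFun r)) ((θ, μs), ωs) ≤ δ := fun θ hθ => hθ.2.2
  filter_upwards [eventually_concaveRect hK hδ hF hcurv, eventually_exists_crit hK hδ hF hcurv,
    eventually_rect (p := S.redRegular r ε) hK fun θ hθ => (hreg θ hθ).eventually] with ηω h1 h2 h3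
  filter_upwards [h1, h2, h3] with ημ e1 e2 e3
  exact ⟨e1, e3, e2⟩

end ParamSystem

/-- Only interpolation at the iterate itself is needed, so both algorithms are treated alike from
here on. -/
theorem GreedyData.expandV_le_stepV {d n m p : ℕ} (R : GreedyData d n) (S : ParamSystem d n m p)
    (j : ℕ) (alg : Variant) : S.expandV (R.μ j) (R.ω j) ≤ R.stepV S j alg := by
  cases alg
  · exact le_rfl
  · exact le_sup_left

theorem GreedyData.expandW_le_stepW {d n m p : ℕ} (R : GreedyData d n) (S : ParamSystem d n m p)
    (j : ℕ) (alg : Variant) : S.expandW (R.μ j) (R.ω j) ≤ R.stepW S j alg := by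
  cases alg
  · exact le_rfl
  · exact le_sup_left

end MaximalFrequency

/-! ### The lemma: common radii, the full system and the runs -/

open scoped Matrix.Norms.L2Operator in
theorem lemma3p5 {d n m p : ℕ} (S : ParamSystem d n m p)
    -- the feasible set, and the minimizer `μs`
    (K : Set (Par d)) (hK : IsCompact K) (hKΩ : K ⊆ S.Ω)
    (hHinf : ∀ μ ∈ K, S.InHinf μ)
    (μs : Par d) (hμs : μs ∈ K) (hmin : IsLocalMinOn S.hinfNorm K μs)
    (hnear : ∀ᶠ μ in 𝓝 μs, S.InHinf μ)
    -- the extension of `σ` to frequencies in `ℝ ∪ {∞}` is continuous at the points of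
    -- `{μs} × (ℝ ∪ {∞})`
    (hcont : ∀ x : OnePoint ℝ,
      ContinuousAt (fun z : Par d × OnePoint ℝ => S.sigmaExt z.1 z.2) (μs, x))
    -- the maximum of `σ(μs, ·)` is attained exactly at `±ωs`; it is a simple singular value
    (ωs : ℝ) (hmax : ∀ x : OnePoint ℝ, S.sigmaExt μs x ≤ S.sigma μs ωs)
    (huniq : ∀ x : OnePoint ℝ, S.sigmaExt μs x = S.sigma μs ωs →
      x = (ωs : OnePoint ℝ) ∨ x = ((-ωs : ℝ) : OnePoint ℝ))
    (hpos : 0 < S.sigma μs ωs) (hsimple : S.sigma2 μs ωs < S.sigma μs ωs)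
    -- a family of runs of one of the algorithms, with `μ^(k) → μs` as `μ^(1) → μs`
    (alg : Variant) (k : ℕ) (hk : 1 ≤ k) {ι : Type*} (R : ι → GreedyData d n)
    (hR : ∀ i, (R i).IsRun S K alg k)
    (hsign : ∀ i, 0 ≤ ωs * (R i).ω k)
    (hconv : Tendsto (fun i => (R i).μ k) (comap (fun i => (R i).μ 1) (𝓝 μs)) (𝓝 μs))
    (δ β : ℝ) (hδ : δ < 0) (hβ : 0 < β)
    (hcurv : iteratedDeriv 2 (S.sigma μs) ωs ≤ δ)
    (hsep : β ≤ sigMin (S.D μs (Complex.I * ωs))) :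
    ∃ ρ > 0, ∃ ημ > 0, ∃ ηω > 0, ∃ ε > 0,
      -- the maximizer of `σ(μ, ·)`, and the smoothness of `‖H[·]‖`
      (∃ w : Par d → ℝ,
        IsCritBranch S.sigma μs ωs ημ ηω μs ωs w ∧ ContDiffOn ℝ 3 w (ball μs ημ) ∧
        (∀ w', IsCritBranch S.sigma μs ωs ημ ηω μs ωs w' → EqOn w' w (closedBall μs ημ)) ∧
        ∀ μ ∈ closedBall μs ημ,
          iteratedDeriv 2 (S.sigma μ) (w μ) ≤ δ / 2 ∧
          ε ≤ S.sigma μ (w μ) - S.sigma2 μ (w μ) ∧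
          (∀ ω, S.sigma μ ω ≤ S.sigma μ (w μ)) ∧
          (∀ ω, S.sigma μ ω = S.sigma μ (w μ) → ω = w μ ∨ ω = -w μ) ∧
          S.hinfNorm μ = S.sigma μ (w μ)) ∧
      ContDiffOn ℝ 3 S.hinfNorm (ball μs ημ) ∧
      -- the local maximizer of `σ^{V_k,W_k}(μ, ·)`, for all runs that start close to `μs`
      (∀ i, ‖(R i).μ 1 - μs‖ < ρ →
        iteratedDeriv 2 (S.redSigma ((R i).V k) ((R i).W k) μs) ωs ≤ δ →
        β ≤ sigMin (S.redD ((R i).V k) ((R i).W k) μs (Complex.I * ωs)) →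
        ∃ w : Par d → ℝ,
          IsCritBranch (S.redSigma ((R i).V k) ((R i).W k)) μs ωs ημ ηω ((R i).μ k) ((R i).ω k) w ∧
          ContDiffOn ℝ 3 w (ball μs ημ) ∧
          (∀ w', IsCritBranch (S.redSigma ((R i).V k) ((R i).W k)) μs ωs ημ ηω
            ((R i).μ k) ((R i).ω k) w' → EqOn w' w (closedBall μs ημ)) ∧
          (∀ μ ∈ closedBall μs ημ,
            iteratedDeriv 2 (S.redSigma ((R i).V k) ((R i).W k) μ) (w μ) ≤ δ / 2 ∧
            ε ≤ S.redSigma ((R i).V k) ((R i).W k) μ (w μ)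
              - S.redSigma2 ((R i).V k) ((R i).W k) μ (w μ) ∧
            ∀ ω ∈ closedBall ωs ηω, ω ≠ w μ →
              S.redSigma ((R i).V k) ((R i).W k) μ ω
                < S.redSigma ((R i).V k) ((R i).W k) μ (w μ) ∧
              ¬ HasDerivAt (S.redSigma ((R i).V k) ((R i).W k) μ) 0 ω) ∧
          ContDiffOn ℝ 3 (fun μ => S.redSigma ((R i).V k) ((R i).W k) μ (w μ)) (ball μs ημ)) ∧
      -- the bounds on the derivatives of order two and three
      ∀ η' ∈ Ioo 0 ημ, ∃ γ > 0,
        (∀ μ ∈ closedBall μs η',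
          (∀ q r, |partialD q (partialD r S.hinfNorm) μ| ≤ γ) ∧
          (∀ q r l, |partialD q (partialD r (partialD l S.hinfNorm)) μ| ≤ γ)) ∧
        (∀ i, ‖(R i).μ 1 - μs‖ < ρ →
          iteratedDeriv 2 (S.redSigma ((R i).V k) ((R i).W k) μs) ωs ≤ δ →
          β ≤ sigMin (S.redD ((R i).V k) ((R i).W k) μs (Complex.I * ωs)) →
          ∀ w : Par d → ℝ,
            IsCritBranch (S.redSigma ((R i).V k) ((R i).W k)) μs ωs ημ ηω
              ((R i).μ k) ((R i).ω k) w →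
            ∀ μ ∈ closedBall μs η',
              (∀ q r, |partialD q (partialD r
                (fun ν => S.redSigma ((R i).V k) ((R i).W k) ν (w ν))) μ| ≤ γ) ∧
              (∀ q r l, |partialD q (partialD r (partialD l
                (fun ν => S.redSigma ((R i).V k) ((R i).W k) ν (w ν)))) μ| ≤ γ)) := by
  -- the full system is the reduced one for the identity matrices
  have hμsΩ : μs ∈ S.Ω := hKΩ hμs
  let θ₁ : Matrix (Fin n) (Fin n) ℂ × Matrix (Fin n) (Fin n) ℂ := (1, 1)
  have hred : θ₁ ∈ S.reducers μs ωs β n := by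
    refine ⟨by simp [θ₁], by simp [θ₁], fun x => ?_⟩
    rw [S.redD_one]
    exact (mul_le_mul_of_nonneg_right hsep (norm_nonneg x)).trans (sigMin_mul_norm_le _ x)
  have hDs : (S.D μs (Complex.I * ωs)).det ≠ 0 := by
    have := S.det_ne_zero_of_mem_reducers hβ hred
    rwa [S.redD_one] at this
  -- Two losses are budgeted: the full gap exceeds 3ε near (μs, ωs), the reduced gap at (μs, ωs) is
  -- then at least 2ε, and on the whole rectangle gaps exceed ε.
  obtain ⟨ε, hε, hgap⟩ : ∃ ε > 0, 3 * ε < S.sigma μs ωs - S.sigma2 μs ωs :=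
    ⟨(S.sigma μs ωs - S.sigma2 μs ωs) / 4, by linarith, by linarith⟩
  have hθ₁ : θ₁ ∈ S.gapReducers μs ωs β ε δ n := by
    refine ⟨hred, ?_, ?_⟩
    · rw [S.redSigma_one, S.redSigma2_one]; linarith
    · rw [← S.iteratedDeriv_two_redSigma, S.redSigma_one]; exact hcurv
  have hmaxs : ∀ ω, S.sigma μs ω ≤ S.sigma μs ωs := ParamSystem.sigma_le_of_sigmaExt_le hmax
  have hσc : ContinuousAt (fun μ => S.sigma μ ωs) μs := by
    have h1 := S.continuousAt_redSigma (z := ((θ₁, μs), ωs)) hμsΩ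
      (S.det_ne_zero_of_mem_reducers hβ hred)
    have h2 := h1.comp (f := fun μ : Par d => ((θ₁, μ), ωs)) (x := μs) (by fun_prop)
    simpa only [Function.comp_def, θ₁, S.redSigma_one] using h2
  have hlt : ∀ η > 0, ∀ᶠ μ in 𝓝 μs, ∀ ω : ℝ, ω ∉ ball ωs η → ω ∉ ball (-ωs) η →
      S.sigma μ ω < S.sigma μ ωs :=
    fun η hη => ParamSystem.eventually_sigma_lt hcont hmax huniq hpos hσc hη
  -- the radii
  have hrect : ∀ᶠ ηω in 𝓝[>] (0 : ℝ), ∀ᶠ ημ in 𝓝[>] (0 : ℝ), ∀ r ∈ Finset.range (n + 1),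
      S.BranchRect (S.gapReducers μs ωs β ε δ r) δ ε μs ωs ημ ηω := by
    have h1 := (Filter.eventually_all_finset (Finset.range (n + 1))).2 fun r _ =>
      S.eventually_branchRect (ωs := ωs) hμsΩ hδ hβ hε r
    filter_upwards [h1] with ηω h2
    exact (Filter.eventually_all_finset (Finset.range (n + 1))).2 h2
  -- The frequency radius is fixed first: how close μ must be to μs for `hlt ηω` to apply depends on
  -- it.
  obtain ⟨ηω, hrect, hηω⟩ := (hrect.and self_mem_nhdsWithin).exists
  replace hηω : 0 < ηω := hηω
  obtain ⟨ημ, ⟨hrect, hnear'⟩, hημ⟩ := ((hrect.and (eventually_closedBall_of_eventually_nhds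
    (hnear.and (hlt ηω hηω)))).and self_mem_nhdsWithin).exists
  replace hημ : 0 < ημ := hημ
  have hμs_mem : μs ∈ closedBall μs ημ := mem_closedBall_self hημ.le
  have hωs_mem : ωs ∈ closedBall ωs (ηω / 2) := mem_closedBall_self (by linarith)
  have hsub2 : closedBall ωs (ηω / 2) ⊆ closedBall ωs ηω := closedBall_subset_closedBall (by linarith)
  have hrect₁ := hrect n (by simp)
  have hslice : ∀ μ, (fun t => S.redFun n ((θ₁, μ), t)) = S.sigma μ := fun μ => by
    funext t; simp [ParamSystem.redFun, θ₁, S.redSigma_one]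
  have hσd : ∀ μ ∈ closedBall μs ημ, ∀ ω ∈ closedBall ωs ηω, (∀ ω', S.sigma μ ω' ≤ S.sigma μ ω) →
      HasDerivAt (S.sigma μ) 0 ω ∧ derivSnd (S.redFun n) ((θ₁, μ), ω) = 0 := by
    intro μ hμ ω hω hm
    have h1 := (hrect₁.concave θ₁ hθ₁).hasDerivAt hμ hω
    rw [hslice] at h1
    have h2 : derivSnd (S.redFun n) ((θ₁, μ), ω) = 0 :=
      IsLocalMax.hasDerivAt_eq_zero (Eventually.of_forall hm) h1
    rw [h2] at h1
    exact ⟨h1, h2⟩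
  have hcrit₁ := (hσd μs hμs_mem ωs (hsub2 hωs_mem) hmaxs).2
  obtain ⟨w, hw, hwb, hw3, hwu, hwp, hws⟩ := S.exists_branch hδ hε.le (hrect₁.concave θ₁ hθ₁)
    (hrect₁.regular θ₁ hθ₁) hμs_mem (hsub2 hωs_mem) hcrit₁
    (hrect₁.exists_crit θ₁ hθ₁ μs hμs_mem ωs hωs_mem hcrit₁)
  simp only [θ₁, S.redSigma_one, S.redSigma2_one] at hwb hwu hwp hws
  -- Three regions: concavity near ωs, evenness near -ωs, and elsewhere comparison with σ(μ, ωs),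
  -- which is at most σ(μ, w μ).
  have hglobal : ∀ μ ∈ closedBall μs ημ, ∀ ω, ω ≠ w μ → ω ≠ -w μ →
      S.sigma μ ω < S.sigma μ (w μ) := by
    intro μ hμ ω h1 h2
    by_cases hω : ω ∈ ball ωs ηω
    · exact ((hwp μ hμ).2.2 ω (ball_subset_closedBall hω) h1).1
    by_cases hω' : ω ∈ ball (-ωs) ηω
    · rw [← S.sigma_neg]
      refine ((hwp μ hμ).2.2 (-ω) ?_ fun h => h2 (by rw [← h, neg_neg])).1
      rw [mem_ball, Real.dist_eq] at hω'
      rw [mem_closedBall, Real.dist_eq, ← abs_neg]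
      convert! hω'.le using 2
      ring
    · refine ((hnear' μ hμ).2 ω hω hω').trans_le ?_
      by_cases h : ωs = w μ
      · rw [← h]
      · exact ((hwp μ hμ).2.2 ωs (hsub2 hωs_mem) h).1.le
  have hmaxw : ∀ μ ∈ closedBall μs ημ, ∀ ω, S.sigma μ ω ≤ S.sigma μ (w μ) := by
    intro μ hμ ω
    by_cases h1 : ω = w μ
    · rw [h1]
    by_cases h2 : ω = -w μ
    · rw [h2, S.sigma_neg]
    exact (hglobal μ hμ ω h1 h2).le
  have hnorm : ∀ μ ∈ closedBall μs ημ, S.hinfNorm μ = S.sigma μ (w μ) := by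
    intro μ hμ
    refine ParamSystem.hinfNorm_eq (hnear' μ hμ).1 ?_ (hmaxw μ hμ)
    have := (hrect₁.regular θ₁ hθ₁ μ hμ _ (hw μ hμ).1).2.1
    rwa [S.redD_one] at this
  -- the runs
  obtain ⟨k, rfl⟩ : ∃ k', k = k' + 1 := ⟨k - 1, by omega⟩
  have hev : ∀ᶠ v : Par d × ℝ in 𝓝 (μs, ωs), 3 * ε < S.sigma v.1 v.2 - S.sigma2 v.1 v.2 ∧
      ∀ r ∈ Finset.range (n + 1), ∀ θ ∈ S.reducers μs ωs β r,
        (S.redD θ.1 θ.2 v.1 (Complex.I * v.2)).det ≠ 0 ∧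
        (3 * ε ≤ S.redSigma θ.1 θ.2 v.1 v.2 - S.redSigma2 θ.1 θ.2 v.1 v.2 →
          2 * ε ≤ S.redSigma θ.1 θ.2 μs ωs - S.redSigma2 θ.1 θ.2 μs ωs) := by
    refine Filter.Eventually.and ?_ ((Filter.eventually_all_finset _).2 fun r _ =>
      S.eventually_gap_of_gap hμsΩ hβ hε)
    have h1 : S.redRegular n (3 * ε) ((θ₁, μs), ωs) := by
      refine ⟨hμsΩ, S.det_ne_zero_of_mem_reducers hβ hred, ?_⟩
      simpa only [θ₁, S.redSigma_one, S.redSigma2_one] using hgap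
    have h2 : Tendsto (fun v : Par d × ℝ => ((θ₁, v.1), v.2)) (𝓝 (μs, ωs))
        (𝓝 ((θ₁, μs), ωs)) := Continuous.tendsto (by fun_prop) (μs, ωs)
    filter_upwards [h2.eventually (h1.eventually S)] with v hv
    simpa only [θ₁, S.redSigma_one, S.redSigma2_one] using hv.2.2
  obtain ⟨e, he, hev⟩ := Metric.eventually_nhds_iff.1 hev
  -- Continuation of a critical point needs distance at most ηω/2 from ωs; the transfer of the gap
  -- needs distance less than e.
  let η₂ : ℝ := min (ηω / 2) e
  have hη₂ : 0 < η₂ := lt_min (by linarith) he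
  have hρ : ∃ ρ > 0, ∀ i, ‖(R i).μ 1 - μs‖ < ρ → (R i).μ (k + 1) ∈ closedBall μs ημ ∧
      dist ((R i).μ (k + 1)) μs < e ∧ ∀ ω : ℝ, ω ∉ ball ωs η₂ → ω ∉ ball (-ωs) η₂ →
        S.sigma ((R i).μ (k + 1)) ω < S.sigma ((R i).μ (k + 1)) ωs := by
    -- Along the pulled-back filter, an eventual property holds for all runs whose first iterate is
    -- within some ρ of μs; this gives a ρ common to the family.
    have h1 := hconv.eventually (Filter.Eventually.and (closedBall_mem_nhds μs hημ)
      (Filter.Eventually.and (ball_mem_nhds μs he) (hlt η₂ hη₂)))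
    rw [eventually_comap] at h1
    obtain ⟨ρ, hρ, h2⟩ := Metric.eventually_nhds_iff.1 h1
    exact ⟨ρ, hρ, fun i hi => h2 (by rwa [dist_eq_norm]) i rfl⟩
  obtain ⟨ρ, hρ, hclose⟩ := hρ
  -- This collects all that is used about an admissible run: its bases lie in the compact family,
  -- and its last iterate is a critical point close to (μs, ωs).
  have hadm : ∀ i, ‖(R i).μ 1 - μs‖ < ρ →
      iteratedDeriv 2 (S.redSigma ((R i).V (k + 1)) ((R i).W (k + 1)) μs) ωs ≤ δ →
      β ≤ sigMin (S.redD ((R i).V (k + 1)) ((R i).W (k + 1)) μs (Complex.I * ωs)) →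
      (R i).r (k + 1) ∈ Finset.range (n + 1) ∧
      ((R i).V (k + 1), (R i).W (k + 1)) ∈ S.gapReducers μs ωs β ε δ ((R i).r (k + 1)) ∧
      (R i).μ (k + 1) ∈ closedBall μs ημ ∧ (R i).ω (k + 1) ∈ closedBall ωs (ηω / 2) ∧
      derivSnd (S.redFun ((R i).r (k + 1)))
        ((((R i).V (k + 1), (R i).W (k + 1)), (R i).μ (k + 1)), (R i).ω (k + 1)) = 0 := by
    intro i hi hci hsi
    obtain ⟨hμB, hμe, hfar⟩ := hclose i hi
    obtain ⟨-, hDu, hωmax⟩ := (hR i).argmax k (Nat.lt_succ_self k)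
    have hr : (R i).r (k + 1) ∈ Finset.range (n + 1) :=
      Finset.mem_range_succ_iff.2 (le_of_conjTranspose_mul_self_eq_one ((hR i).orthV _ le_rfl))
    have hmem : ((R i).V (k + 1), (R i).W (k + 1)) ∈ S.reducers μs ωs β ((R i).r (k + 1)) :=
      ⟨(hR i).orthV _ le_rfl, (hR i).orthW _ le_rfl, fun x =>
        (mul_le_mul_of_nonneg_right hsi (norm_nonneg x)).trans (sigMin_mul_norm_le _ x)⟩
    -- A maximizer must be close to ωs or to -ωs. In the second case the sign convention gives |ω -
    -- ωs| ≤ |ω + ωs|, so it is close to ωs anyway.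
    have hωball : (R i).ω (k + 1) ∈ ball ωs η₂ := by
      by_contra hnot
      by_cases h2 : (R i).ω (k + 1) ∈ ball (-ωs) η₂
      · refine hnot ?_
        rw [mem_ball, Real.dist_eq] at h2 ⊢
        refine lt_of_le_of_lt (sq_le_sq.1 ?_) h2
        nlinarith [hsign i]
      · exact absurd (hωmax ωs) (not_le.2 (hfar _ hnot h2))
    have hω2 : (R i).ω (k + 1) ∈ closedBall ωs (ηω / 2) :=
      mem_closedBall.2 ((mem_ball.1 hωball).le.trans (min_le_left _ _))
    obtain ⟨hg, hN⟩ := hev (y := ((R i).μ (k + 1), (R i).ω (k + 1))) (by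
      rw [Prod.dist_eq]
      exact max_lt hμe ((mem_ball.1 hωball).trans_le (min_le_right _ _)))
    obtain ⟨hDr, hN⟩ := hN _ hr _ hmem
    have hV : S.expandV ((R i).μ (k + 1)) ((R i).ω (k + 1)) ≤ colSpace ((R i).V (k + 1)) := by
      rw [(hR i).colV k (Nat.lt_succ_self k)]
      exact ((R i).expandV_le_stepV S (k + 1) alg).trans le_sup_right
    have hW : S.expandW ((R i).μ (k + 1)) ((R i).ω (k + 1)) ≤ colSpace ((R i).W (k + 1)) := by
      rw [(hR i).colW k (Nat.lt_succ_self k)]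
      exact ((R i).expandW_le_stepW S (k + 1) alg).trans le_sup_right
    -- The two transfer matrices coincide at the last iterate, so the reduced system has the gap of
    -- the full one there.
    have hH := (S.redH_hermite hV hW hDu.ne_zero hDr).1
    have hmem' : ((R i).V (k + 1), (R i).W (k + 1)) ∈
        S.gapReducers μs ωs β ε δ ((R i).r (k + 1)) := by
      refine ⟨hmem, hN ?_, ?_⟩
      · simp only [ParamSystem.redSigma, ParamSystem.redSigma2, hH]
        exact hg.le
      · rw [← S.iteratedDeriv_two_redSigma]; exact hci
    refine ⟨hr, hmem', hμB, hω2, ?_⟩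
    have hdiff := ((hrect _ hr).concave _ hmem').hasDerivAt hμB (hsub2 hω2)
    have hσpos : S.sigma ((R i).μ (k + 1)) ((R i).ω (k + 1)) ≠ 0 := by
      have h1 : 0 ≤ S.sigma2 ((R i).μ (k + 1)) ((R i).ω (k + 1)) := sigSnd_nonneg _
      simp only at hg
      exact ne_of_gt (by linarith)
    exact (S.hasDerivAt_redSigma_zero hV hW hDu.ne_zero hDr hσpos
      (hσd _ hμB _ (hsub2 hω2) hωmax).1 hdiff.differentiableAt).deriv
  refine ⟨ρ, hρ, ημ, hημ, ηω, hηω, ε, hε, ⟨w, hwb, hw3, hwu, fun μ hμ => ⟨(hwp μ hμ).1,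
    (hwp μ hμ).2.1, hmaxw μ hμ, fun ω hω => ?_, hnorm μ hμ⟩⟩, ?_, fun i hi hci hsi => ?_, ?_⟩
  · by_contra! h
    exact (hglobal μ hμ ω h.1 h.2).ne hω
  · exact hws.congr fun μ hμ => hnorm μ (ball_subset_closedBall hμ)
  · obtain ⟨hr, hmem, hμB, hω2, h0⟩ := hadm i hi hci hsi
    obtain ⟨v, -, hv⟩ := S.exists_branch hδ hε.le ((hrect _ hr).concave _ hmem)
      ((hrect _ hr).regular _ hmem) hμB (hsub2 hω2) h0
      ((hrect _ hr).exists_crit _ hmem _ hμB _ hω2 h0)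
    exact ⟨v, hv⟩
  · rintro η' ⟨-, hη'⟩
    have hbound : ∀ r ∈ Finset.range (n + 1), ∃ γ > 0, ∀ θ ∈ S.gapReducers μs ωs β ε δ r,
        ∀ w : Par d → ℝ, ContinuousOn w (closedBall μs ημ) →
        (∀ μ ∈ closedBall μs ημ,
          w μ ∈ closedBall ωs ηω ∧ derivSnd (S.redFun r) ((θ, μ), w μ) = 0) →
        ∀ μ ∈ closedBall μs η',
          (∀ q r', |partialD q (partialD r' (fun ν => S.redFun r ((θ, ν), w ν))) μ| ≤ γ) ∧
          (∀ q r' l,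
            |partialD q (partialD r' (partialD l (fun ν => S.redFun r ((θ, ν), w ν)))) μ| ≤ γ) :=
      fun r hr => exists_partialD_bound (S.isCompact_gapReducers hμsΩ hβ hε)
        (by linarith) (hrect r hr).concave hη'
    choose! γ hγ hbd using hbound
    -- Summing over the finitely many sizes gives one bound for all runs, and the term r = n covers
    -- the full system.
    have hle : ∀ r ∈ Finset.range (n + 1), γ r ≤ ∑ r ∈ Finset.range (n + 1), γ r :=
      fun r hr => Finset.single_le_sum (fun r hr => (hγ r hr).le) hr
    have hn : n ∈ Finset.range (n + 1) := by simp
    refine ⟨∑ r ∈ Finset.range (n + 1), γ r, (hγ n hn).trans_le (hle n hn), fun μ hμ => ?_,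
      fun i hi hci hsi v hv μ hμ => ?_⟩
    · obtain ⟨h2, h3⟩ := hbd n hn θ₁ hθ₁ w hwb.cont hw μ hμ
      have heq : S.hinfNorm =ᶠ[𝓝 μ] fun ν => S.redFun n ((θ₁, ν), w ν) := by
        filter_upwards [isOpen_ball.mem_nhds ((mem_closedBall.1 hμ).trans_lt hη')] with ν hν
        rw [hnorm ν (ball_subset_closedBall hν)]
        exact (congrFun (hslice ν) (w ν)).symm
      refine ⟨fun q r => ?_, fun q r l => ?_⟩
      · rw [(partialD_congr (partialD_congr heq r) q).eq_of_nhds]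
        exact (h2 q r).trans (hle n hn)
      · rw [(partialD_congr (partialD_congr (partialD_congr heq l) r) q).eq_of_nhds]
        exact (h3 q r l).trans (hle n hn)
    · obtain ⟨hr, hmem, -⟩ := hadm i hi hci hsi
      obtain ⟨h2, h3⟩ := hbd _ hr _ hmem v hv.cont
        (fun ν hν => ⟨hv.maps hν, (hv.crit ν hν).deriv⟩) μ hμ
      exact ⟨fun q r => (h2 q r).trans (hle _ hr), fun q r l => (h3 q r l).trans (hle _ hr)⟩
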